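/- Let $d\ge 1$ and $r>0$. Let $B_r^d\subset\mathbb{R}^d$ be the closed ball of radius $r$ centred at the origin, let $S_+^{d-1}$ be the upper unit hemisphere (unit vectors with nonnegative last coordinate), let $\kappa_n=\pi^{n/2}/\Gamma(n/2+1)$ be the volume of the unit ball in $\mathbb{R}^n$, and let $B(s,t)=\Gamma(s)\Gamma(t)/\Gamma(s+t)$ be Euler's Beta function. For $p\in\mathbb{R}$ and $v\in S_+^{d-1}$ put $H(p,v)=\{x\in\mathbb{R}^d:\langle x,v\rangle=p\}$. Put $\chi(K)=1$ if $K\neq\emptyset$ and $\chi(\emptyset)=0$, and let $\nu_k$ be $k$-dimensional volume (normalized $k$-dimensional Hausdorff measure; $\nu_0$ is the counting measure). Let $X_i=(P_i,V_i)$, $i\ge 1$, be i.i.d. random vectors, where $P_i$ and $V_i$ are independent, $P_i$ is uniformly distributed on $[-r,r]$, and (isotropy) $V_i$ is uniformly distributed on $S_+^{d-1}$. For $k,l\in\{0,\dots,d-1\}$ define $$\sigma_{\chi,k,l}=\mathbb{E}\Big[\chi\Big(\bigcap_{i=1}^{d-k}H(X_i)\cap B_r^d\Big)\,\chi\Big(\bigcap_{i=d-k}^{2d-k-l-1}H(X_i)\cap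 B_r^d\Big)\Big],$$ $$\sigma_{\nu,k,l}=r^{-(k+l)}\,\mathbb{E}\Big[\nu_k\Big(\bigcap_{i=1}^{d-k}H(X_i)\cap B_r^d\Big)\,\nu_l\Big(\bigcap_{i=d-k}^{2d-k-l-1}H(X_i)\cap B_r^d\Big)\Big],$$ and $\sigma_{\chi,k}=\sigma_{\chi,k,k}$, $\sigma_{\nu,k}=\sigma_{\nu,k,k}$. Then, for all $k,l\in\{0,\dots,d-1\}$, $$\sigma_{\chi,k,l}=\frac{(d!\,\kappa_d)^2\,\kappa_{d-k-1}\,\kappa_{d-l-1}\,\kappa_{2d-k-l-1}}{k!\,l!\,\kappa_k\,\kappa_l\,2^{2d-k-l-1}\,\kappa_{2d-k-l-2}}\Big(\frac{\kappa_{d-1}}{d\,\kappa_d}\Big)^{2d-k-l}=\sqrt{\sigma_{\chi,k}\,\sigma_{\chi,l}}\;\frac{B\big(\tfrac{2d-k-l}{2},\tfrac{2d-k-l}{2}\big)}{\sqrt{B(d-k,d-k)\,B(d-l,d-l)}}$$ and $$\sigma_{\nu,k,l}=\frac{(\kappa_d\,\kappa_{d-1}\,d!\,(d-1)!)^2\,2^{k+l}}{k!\,l!\,\kappa_k\,\kappa_l\,(2d-1)!}\Big(\frac{\kappa_{d-1}}{d\,\kappa_d}\Big)^{2d-k-l}=\sqrt{\sigma_{\nu,k}\,\sigma_{\nu,l}}.$$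 -/

import Mathlib

open MeasureTheory ProbabilityTheory
open scoped Nat

namespace PoissonHyperplane

/-- Volume `κ_n` of the closed unit ball of `ℝⁿ`. -/
noncomputable def kappa (n : ℕ) : ℝ :=
  (volume (Metric.closedBall (0 : EuclideanSpace ℝ (Fin n)) 1)).toReal

/-- The unit sphere `S^{d-1}` of `ℝᵈ`, as a type. -/
abbrev UnitSphere (d : ℕ) : Type := Metric.sphere (0 : EuclideanSpace ℝ (Fin d)) 1

/-- The closed upper unit hemisphere `S_+^{d-1}`: unit vectors whose last coordinate is
nonnegative. -/
def upperHemisphere (d : ℕ) : Set (UnitSphere d) :=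
  {v | ∀ i : Fin d, (i : ℕ) + 1 = d → 0 ≤ (v : EuclideanSpace ℝ (Fin d)) i}

/-- The uniform distribution on the upper unit hemisphere: the surface measure of the sphere,
restricted to the hemisphere and normalized to total mass one. -/
noncomputable def uniformHemisphere (d : ℕ) : Measure (UnitSphere d) :=
  ProbabilityTheory.cond
    (volume : Measure (EuclideanSpace ℝ (Fin d))).toSphere (upperHemisphere d)

/-- The hyperplane `H(p, v) = {y : ⟨y, v⟩ = p}`. -/
def hyperplane {d : ℕ} (x : ℝ × UnitSphere d) : Set (EuclideanSpace ℝ (Fin d)) :=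
  {y | inner ℝ y (x.2 : EuclideanSpace ℝ (Fin d)) = x.1}

/-- The part inside the closed ball of radius `r` about the origin of the intersection of the
hyperplanes `H(x i)`, `i ∈ s`. -/
def flatInBall {d : ℕ} (r : ℝ) (x : ℕ → ℝ × UnitSphere d) (s : Finset ℕ) :
    Set (EuclideanSpace ℝ (Fin d)) :=
  (⋂ i ∈ s, hyperplane (x i)) ∩ Metric.closedBall 0 r

open Classical in
/-- `χ(K) = 1` if `K` is nonempty and `χ(∅) = 0`. -/
noncomputable def chi {d : ℕ} (K : Set (EuclideanSpace ℝ (Fin d))) : ℝ :=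
  if K.Nonempty then 1 else 0

/-- `k`-dimensional volume in `ℝᵈ`: `k`-dimensional Hausdorff measure, normalized so that it agrees
with Lebesgue measure on `k`-dimensional flats. -/
noncomputable def nu {d : ℕ} (k : ℕ) (K : Set (EuclideanSpace ℝ (Fin d))) : ℝ :=
  (Measure.euclideanHausdorffMeasure k K).toReal

/-- `X₁, X₂, …` are i.i.d. random pairs `Xᵢ = (Pᵢ, Vᵢ)` with independent components, where `Pᵢ` is
uniform on `[-r, r]` and `Vᵢ` has distribution `Θ`. In the code `X i` stands for `X_{i+1}`. -/
structure IsHyperplaneSample {Ω : Type*} [MeasurableSpace Ω] (P : Measure Ω) {d : ℕ} (r : ℝ)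
    (Θ : Measure (UnitSphere d)) (X : ℕ → Ω → ℝ × UnitSphere d) : Prop where
  indep : iIndepFun X P
  law : ∀ i, HasLaw (X i) ((ProbabilityTheory.cond volume (Set.Icc (-r) r)).prod Θ) P

section Moments

variable {Ω : Type*} [MeasurableSpace Ω] (P : Measure Ω) {d : ℕ} (r : ℝ)
  (X : ℕ → Ω → ℝ × UnitSphere d)

/-- `σ_{χ,k}`, the mean of
`χ(H(X₁) ∩ … ∩ H(X_{d-k}) ∩ B_r) χ(H(X_{d-k}) ∩ … ∩ H(X_{2d-2k-1}) ∩ B_r)`. -/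
noncomputable def sigmaChi (k : ℕ) : ℝ :=
  ∫ ω, chi (flatInBall r (fun i => X i ω) (Finset.range (d - k))) *
    chi (flatInBall r (fun i => X i ω) (Finset.Ico (d - k - 1) (2 * d - 2 * k - 1))) ∂P

/-- `σ_{ν,k}`, the mean of
`r^{-2k} ν_k(H(X₁) ∩ … ∩ H(X_{d-k}) ∩ B_r) ν_k(H(X_{d-k}) ∩ … ∩ H(X_{2d-2k-1}) ∩ B_r)`. -/
noncomputable def sigmaNu (k : ℕ) : ℝ :=
  (r ^ (2 * k))⁻¹ *
    ∫ ω, nu k (flatInBall r (fun i => X i ω) (Finset.range (d - k))) *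
      nu k (flatInBall r (fun i => X i ω) (Finset.Ico (d - k - 1) (2 * d - 2 * k - 1))) ∂P

/-- `σ_{χ,k,l}`, the mean of
`χ(H(X₁) ∩ … ∩ H(X_{d-k}) ∩ B_r) χ(H(X_{d-k}) ∩ … ∩ H(X_{2d-k-l-1}) ∩ B_r)`: exactly the
hyperplane `H(X_{d-k})` is shared. -/
noncomputable def sigmaChiMixed (k l : ℕ) : ℝ :=
  ∫ ω, chi (flatInBall r (fun i => X i ω) (Finset.range (d - k))) *
    chi (flatInBall r (fun i => X i ω) (Finset.Ico (d - k - 1) (2 * d - k - l - 1))) ∂P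

/-- `σ_{ν,k,l}`, the mean of
`r^{-(k+l)} ν_k(H(X₁) ∩ … ∩ H(X_{d-k}) ∩ B_r) ν_l(H(X_{d-k}) ∩ … ∩ H(X_{2d-k-l-1}) ∩ B_r)`. -/
noncomputable def sigmaNuMixed (k l : ℕ) : ℝ :=
  (r ^ (k + l))⁻¹ *
    ∫ ω, nu k (flatInBall r (fun i => X i ω) (Finset.range (d - k))) *
      nu l (flatInBall r (fun i => X i ω) (Finset.Ico (d - k - 1) (2 * d - k - l - 1))) ∂P

end Moments

end PoissonHyperplane

namespace PoissonHyperplane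

/-! To a flat `F` and an exponent `b` attach the weight `ballWeight r b F`: the `b`-th power of the
radius of `F ∩ B_r`, or `0` if `F` misses `B_r`. Exponent `0` gives `χ`, and `κ_k` times exponent
`k` gives `ν_k` of a `k`-flat. With `q = κ_{d-1}/(d κ_d)`, cutting a fixed `(j+1)`-flat `F` by one
random hyperplane satisfies `E w_b(F ∩ H) = (q/2r) · (j+1)κ_{j+1}/κ_j · κ_{b+1}/κ_b · w_{b+1}(F)`
(`lintegral_ballWeight_inter_hyperplane`). Integrating over the offset `P` gives a half-chord
integral, hence `κ_{b+1}/κ_b` times the length of the projection of `V` onto the direction of `F`;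
the mean of this length over the sphere follows from a Gaussian integral computed in two ways.

The dimension drops by one and the exponent rises by one, so the formula iterates and its factors
telescope (`lintegral_ballWeight_inter`). For the mixed moment, fix the shared hyperplane: the
remaining two families are independent, each mean is a constant times a weight of that hyperplane,
and the two weights multiply by adding exponents to some `n`. A last integration, over the shared
hyperplane, gives `κ_{n+1}/κ_n = 2^{n+1} B(n/2+1, n/2+1)` (`lintegral_ballWeight_mul`,
`kappa_succ_div_kappa_eq_beta`).

Hence each moment is (factor in `k`) · (factor in `l`) · Beta. For `χ`, `n = 2d-k-l-2`, which leaves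
the quotient of Beta values; for `ν`, `n = 2d-2` whatever `k` and `l` are, so the moment factorizes
exactly. -/

/-! ### Ball volumes, half-chord integrals and the Beta function. -/

theorem kappa_eq (n : ℕ) : kappa n = √Real.pi ^ n / Real.Gamma (n / 2 + 1) := by
  rcases Nat.eq_zero_or_pos n with rfl | hn
  · have : Metric.closedBall (0 : EuclideanSpace ℝ (Fin 0)) 1 = Set.univ :=
      Set.eq_univ_of_forall fun x => by simp [Subsingleton.elim x 0]
    simp only [kappa, this]
    have h := (PiLp.volume_preserving_toLp (Fin 0)).measure_preimage
      MeasurableSet.univ.nullMeasurableSet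
    rw [← h]
    simp [volume_pi]
  · have : Nonempty (Fin n) := Fin.pos_iff_nonempty.mp hn
    rw [kappa, EuclideanSpace.volume_closedBall]
    have : 0 ≤ √Real.pi ^ n / Real.Gamma (n / 2 + 1) :=
      div_nonneg (by positivity) (Real.Gamma_pos_of_pos (by positivity)).le
    simp [ENNReal.toReal_ofReal this]

theorem kappa_pos (n : ℕ) : 0 < kappa n := by
  rw [kappa_eq]
  exact div_pos (by positivity) (Real.Gamma_pos_of_pos (by positivity))

theorem kappa_zero : kappa 0 = 1 := by simp [kappa_eq]

theorem kappa_add_two (n : ℕ) : kappa (n + 2) = 2 * Real.pi / (n + 2) * kappa n := by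
  have hG := Real.Gamma_pos_of_pos (show (0 : ℝ) < n / 2 + 1 by positivity)
  rw [kappa_eq, kappa_eq, show (((n + 2 : ℕ) : ℝ) / 2 + 1) = (n / 2 + 1) + 1 by push_cast; ring,
    Real.Gamma_add_one (by positivity), pow_add, Real.sq_sqrt Real.pi_pos.le]
  field_simp

theorem kappa_one : kappa 1 = 2 := by
  have h : Real.Gamma (1 / 2 + 1) = 1 / 2 * √Real.pi := by
    rw [Real.Gamma_add_one (by norm_num), Real.Gamma_one_half_eq]
  rw [kappa_eq, Nat.cast_one, h]
  have := Real.sqrt_pos.2 Real.pi_pos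
  field_simp

theorem integral_sin_pow_succ_eq_kappa_div (a : ℕ) :
    ∫ x in (0 : ℝ)..Real.pi, Real.sin x ^ (a + 1) = kappa (a + 1) / kappa a := by
  induction a using Nat.twoStepInduction with
  | zero => simp [kappa_zero, kappa_one]; norm_num
  | one =>
    have := kappa_add_two 0
    simp only [zero_add] at this
    simp [kappa_one, this, kappa_zero]
  | more a ih _ =>
    have h1 := kappa_pos a
    have h2 := kappa_pos (a + 1)
    rw [show a + 2 + 1 = (a + 1) + 2 by ring, integral_sin_pow, ih, kappa_add_two, kappa_add_two]
    simp
    field_simp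
    ring

/-- The integral of a power of the half-chord length of a disc of radius `ρ`. -/
theorem integral_sqrt_sq_sub_sq_pow (a : ℕ) {ρ : ℝ} (hρ : 0 ≤ ρ) :
    ∫ t in (-ρ)..ρ, √(ρ ^ 2 - t ^ 2) ^ a = kappa (a + 1) / kappa a * ρ ^ (a + 1) := by
  -- The substitution `t = -ρ cos θ` turns the half-chord length into `ρ sin θ`.
  have h := intervalIntegral.integral_comp_mul_deriv (a := 0) (b := Real.pi)
    (f := fun θ => -(ρ * Real.cos θ)) (f' := fun θ => ρ * Real.sin θ)
    (g := fun t => √(ρ ^ 2 - t ^ 2) ^ a)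
    (fun x _ => by convert! ((Real.hasDerivAt_cos x).const_mul ρ).neg using 1; ring)
    (by fun_prop) (by fun_prop)
  simp only [Real.cos_zero, mul_one, Real.cos_pi, mul_neg, neg_neg] at h
  rw [← h, ← integral_sin_pow_succ_eq_kappa_div, mul_comm, ← intervalIntegral.integral_const_mul]
  refine intervalIntegral.integral_congr fun θ hθ => ?_
  rw [Set.uIcc_of_le Real.pi_pos.le] at hθ
  have hs := Real.sin_nonneg_of_mem_Icc hθ
  have : ρ ^ 2 - (-(ρ * Real.cos θ)) ^ 2 = (ρ * Real.sin θ) ^ 2 := by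
    rw [mul_pow, Real.sin_sq]; ring
  simp only [Function.comp, this, Real.sqrt_sq (mul_nonneg hρ hs)]
  ring

/-- This is Legendre's duplication formula at `a/2 + 1`. -/
theorem kappa_succ_div_kappa_eq_beta (a : ℕ) :
    kappa (a + 1) / kappa a = 2 ^ (a + 1) * beta ((a : ℝ) / 2 + 1) ((a : ℝ) / 2 + 1) := by
  have h0 : (0 : ℝ) < (a : ℝ) / 2 + 1 := by positivity
  have hd := Real.Gamma_mul_Gamma_add_half ((a : ℝ) / 2 + 1)
  have h1 := Real.Gamma_pos_of_pos h0
  have h2 := Real.Gamma_pos_of_pos (show (0 : ℝ) < (a : ℝ) / 2 + 1 + 1 / 2 by positivity)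
  have h3 := Real.Gamma_pos_of_pos (show (0 : ℝ) < 2 * ((a : ℝ) / 2 + 1) by positivity)
  have hp : (2 : ℝ) ^ (1 - 2 * ((a : ℝ) / 2 + 1)) = ((2 : ℝ) ^ (a + 1))⁻¹ := by
    rw [show 1 - 2 * ((a : ℝ) / 2 + 1) = -((a + 1 : ℕ) : ℝ) by push_cast; ring,
      Real.rpow_neg (by norm_num), Real.rpow_natCast]
  rw [hp] at hd
  rw [kappa_eq, kappa_eq, beta, ← two_mul,
    show (((a + 1 : ℕ) : ℝ) / 2 + 1) = (a : ℝ) / 2 + 1 + 1 / 2 by push_cast; ring]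
  field_simp at hd ⊢
  rw [pow_succ (√Real.pi)]
  linear_combination (-√Real.pi ^ a) * hd

theorem beta_nat_succ (n : ℕ) :
    beta ((n : ℝ) + 1) ((n : ℝ) + 1) = (n ! : ℝ) ^ 2 / ((2 * n + 1)! : ℝ) := by
  rw [beta, show (n : ℝ) + 1 + ((n : ℝ) + 1) = ((2 * n + 1 : ℕ) : ℝ) + 1 by push_cast; ring,
    Real.Gamma_nat_eq_factorial, Real.Gamma_nat_eq_factorial, sq]

/-! ### Mean projection length on the sphere, by Gaussian integrals. -/

section Gaussian

variable {E : Type*} [NormedAddCommGroup E] [InnerProductSpace ℝ E] [FiniteDimensional ℝ E]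
  [MeasurableSpace E] [BorelSpace E]

theorem volume_real_closedBall_one :
    (volume : Measure E).real (Metric.closedBall 0 1) = kappa (Module.finrank ℝ E) := by
  rw [kappa, Measure.real, ← ((stdOrthonormalBasis ℝ E).measurePreserving_repr_symm).measure_preimage
      measurableSet_closedBall.nullMeasurableSet]
  congr 2
  ext x
  simp

theorem volume_closedBall_eq_kappa (c : E) {ρ : ℝ} (hρ : 0 ≤ ρ) :
    volume (Metric.closedBall c ρ)
      = ENNReal.ofReal (kappa (Module.finrank ℝ E) * ρ ^ Module.finrank ℝ E) := by
  rw [Measure.addHaar_closedBall' _ _ hρ, ← volume_real_closedBall_one (E := E), mul_comm,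
    ENNReal.ofReal_mul measureReal_nonneg, ofReal_measureReal measure_closedBall_lt_top.ne]

theorem volume_real_ball_one [Nontrivial E] :
    (volume : Measure E).real (Metric.ball 0 1) = kappa (Module.finrank ℝ E) := by
  rw [← volume_real_closedBall_one (E := E), Measure.real, Measure.real,
    Measure.addHaar_closedBall_eq_addHaar_ball]

theorem integral_pow_mul_exp_neg_sq (n : ℕ) :
    ∫ y in Set.Ioi (0 : ℝ), y ^ n * Real.exp (-y ^ 2) = Real.Gamma ((n + 1) / 2) / 2 := by
  have h := integral_rpow_mul_exp_neg_rpow (p := 2) (q := n) (by norm_num)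
    (by have : (0 : ℝ) ≤ n := by positivity
        linarith)
  rw [one_div_mul_eq_div] at h
  rw [← h]
  refine setIntegral_congr_fun measurableSet_Ioi fun y _ => ?_
  simp [Real.rpow_natCast]

theorem integral_norm_mul_exp_neg_norm_sq [Nontrivial E] :
    ∫ x : E, ‖x‖ * Real.exp (-‖x‖ ^ 2) = Module.finrank ℝ E * kappa (Module.finrank ℝ E) *
      (Real.Gamma ((Module.finrank ℝ E + 1) / 2) / 2) := by
  rw [integral_fun_norm_addHaar volume (fun t => t * Real.exp (-t ^ 2)), volume_real_ball_one,
    ← integral_pow_mul_exp_neg_sq, nsmul_eq_mul, smul_eq_mul, mul_assoc]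
  congr 2
  refine setIntegral_congr_fun measurableSet_Ioi fun y _ => ?_
  have h : 0 < Module.finrank ℝ E := Module.finrank_pos
  simp only [smul_eq_mul]
  rw [← mul_assoc, ← pow_succ, Nat.sub_add_cancel h]

theorem integral_exp_neg_norm_sq :
    ∫ x : E, Real.exp (-‖x‖ ^ 2) = √Real.pi ^ Module.finrank ℝ E := by
  have h := GaussianFourier.integral_rexp_neg_mul_sq_norm (V := E) one_pos
  simp only [neg_mul, one_mul, div_one] at h
  rw [h, Real.sqrt_eq_rpow, ← Real.rpow_natCast, ← Real.rpow_mul Real.pi_pos.le]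
  congr 1; ring

/-- The Gaussian weight is a product along the orthogonal splitting `L ⊕ Lᗮ`. -/
theorem integral_norm_projection_mul_exp_neg_norm_sq (L : Submodule ℝ E) :
    ∫ x : E, ‖L.orthogonalProjectionOnto x‖ * Real.exp (-‖x‖ ^ 2) =
      (∫ u : L, ‖u‖ * Real.exp (-‖u‖ ^ 2)) * ∫ w : Lᗮ, Real.exp (-‖w‖ ^ 2) := by
  rw [← integral_prod_mul]
  have h1 := L.orthogonalDecomposition.measurePreserving
  have h2 := (WithLp.volume_preserving_symm_measurableEquiv_toLp_prod L Lᗮ)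
  have h3 := h1.trans (e := L.orthogonalDecomposition.toMeasurableEquiv) h2
  have h4 := h3.integral_comp' (fun z : L × Lᗮ =>
    ‖z.1‖ * Real.exp (-‖z.1‖ ^ 2) * Real.exp (-‖z.2‖ ^ 2))
  rw [Measure.volume_eq_prod] at h4
  rw [← h4]
  refine integral_congr_ae (Filter.Eventually.of_forall fun x => ?_)
  have := L.norm_sq_eq_add_norm_sq_projection x
  simp [this, Real.exp_add]
  ring

/-- Polar coordinates: the projection norm is homogeneous of degree one, so the radial part splits
off. -/
theorem integral_norm_projection_toSphere (L : Submodule ℝ E) [Nontrivial E] :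
    ∫ x : E, ‖L.orthogonalProjectionOnto x‖ * Real.exp (-‖x‖ ^ 2) =
      (∫ v, ‖L.orthogonalProjectionOnto (v : E)‖ ∂(volume : Measure E).toSphere) *
        (Real.Gamma ((Module.finrank ℝ E + 1) / 2) / 2) := by
  have hd : 0 < Module.finrank ℝ E := Module.finrank_pos
  set G : Metric.sphere (0 : E) 1 × Set.Ioi (0 : ℝ) → ℝ := fun z =>
    ‖L.orthogonalProjectionOnto (z.1 : E)‖ * ((z.2 : ℝ) * Real.exp (-(z.2 : ℝ) ^ 2)) with hG
  calc
    _ = ∫ x : ({(0)}ᶜ : Set E),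
          ‖L.orthogonalProjectionOnto (x : E)‖ * Real.exp (-‖(x : E)‖ ^ 2) 
            ∂(volume.comap ((↑) : ({(0)}ᶜ : Set E) → E)) := by
      rw [integral_subtype_comap (measurableSet_singleton _).compl
        fun x => ‖L.orthogonalProjectionOnto x‖ * Real.exp (-‖x‖ ^ 2), restrict_compl_singleton]
    _ = ∫ z, G z ∂((volume : Measure E).toSphere.prod
          (.volumeIoiPow (Module.finrank ℝ E - 1))) := by
      rw [← (volume : Measure E).measurePreserving_homeomorphUnitSphereProd.integral_comp
        (Homeomorph.measurableEmbedding _) G]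
      refine integral_congr_ae (Filter.Eventually.of_forall fun x => ?_)
      have hx : ‖(x : E)‖ ≠ 0 := norm_ne_zero_iff.2 x.2
      simp [hG, norm_smul]
      field_simp
    _ = (∫ v, ‖L.orthogonalProjectionOnto (v : E)‖ ∂(volume : Measure E).toSphere) *
          ∫ x : Set.Ioi (0 : ℝ), (x : ℝ) * Real.exp (-(x : ℝ) ^ 2)
            ∂(.volumeIoiPow (Module.finrank ℝ E - 1)) := by
      rw [hG, ← integral_prod_mul]
    _ = _ := by
      rw [← integral_pow_mul_exp_neg_sq]
      congr 1
      simp only [Measure.volumeIoiPow, ENNReal.ofReal]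
      rw [integral_withDensity_eq_integral_smul,
        integral_subtype_comap measurableSet_Ioi fun a : ℝ =>
          Real.toNNReal (a ^ (Module.finrank ℝ E - 1)) • (a * Real.exp (-a ^ 2))]
      · refine setIntegral_congr_fun measurableSet_Ioi fun x hx => ?_
        rw [NNReal.smul_def, Real.coe_toNNReal _ (pow_nonneg (le_of_lt hx) _), smul_eq_mul,
          ← mul_assoc, ← pow_succ, Nat.sub_add_cancel hd]
      · exact (measurable_subtype_coe.pow_const _).real_toNNReal

/-- Equates the product and the polar evaluation of the same Gaussian integral and solves for the
spherical factor. -/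
theorem integral_norm_projection_toSphere_eq (L : Submodule ℝ E) {j : ℕ}
    (hj : Module.finrank ℝ L = j + 1) :
    ∫ v, ‖L.orthogonalProjectionOnto (v : E)‖ ∂(volume : Measure E).toSphere =
      kappa (Module.finrank ℝ E - 1) * ((j + 1) * kappa (j + 1) / kappa j) := by
  have hL : Nontrivial L := Module.nontrivial_of_finrank_pos (R := ℝ) (by omega)
  have hE : Nontrivial E := Function.Injective.nontrivial L.injective_subtype
  have hd := L.finrank_add_finrank_orthogonal
  obtain ⟨m, hm⟩ : ∃ m, Module.finrank ℝ E = j + 1 + m := ⟨Module.finrank ℝ Lᗮ, by omega⟩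
  have hm' : Module.finrank ℝ Lᗮ = m := by omega
  have h := integral_norm_projection_toSphere L
  rw [integral_norm_projection_mul_exp_neg_norm_sq, integral_norm_mul_exp_neg_norm_sq,
    integral_exp_neg_norm_sq, hj, hm', hm] at h
  have e : ∀ n : ℕ, Real.Gamma ((((n + 1 : ℕ) : ℝ) + 1) / 2) = √Real.pi ^ n / kappa n := by
    intro n
    have := Real.Gamma_pos_of_pos (show (0 : ℝ) < n / 2 + 1 by positivity)
    have hp := Real.sqrt_pos.2 Real.pi_pos
    rw [kappa_eq, show (((n + 1 : ℕ) : ℝ) + 1) / 2 = (n : ℝ) / 2 + 1 by push_cast; ring]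
    field_simp
  have k1 := kappa_pos j
  have k2 := kappa_pos (j + m)
  have hp := Real.sqrt_pos.2 Real.pi_pos
  rw [show j + 1 + m = j + m + 1 by ring, e, e] at h
  rw [hm, show j + 1 + m - 1 = j + m by omega]
  push_cast at h
  field_simp at h ⊢
  rw [pow_add] at h
  have hq : √Real.pi ^ j * √Real.pi ^ m ≠ 0 := by positivity
  apply mul_left_cancel₀ hq
  linear_combination -h

end Gaussian

/-! ### The uniform distribution on the hemisphere. -/

section Hemisphere

section General

variable {E : Type*} [NormedAddCommGroup E] [InnerProductSpace ℝ E] [FiniteDimensional ℝ E]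
  [MeasurableSpace E] [BorelSpace E]

/-- The cone over these directions lies in a proper subspace, which is Lebesgue null. -/
theorem toSphere_preimage_submodule_eq_zero {W : Submodule ℝ E} (hW : W ≠ ⊤) :
    (volume : Measure E).toSphere {v | (v : E) ∈ W} = 0 := by
  have hm : MeasurableSet {v : Metric.sphere (0 : E) 1 | (v : E) ∈ W} :=
    measurable_subtype_coe W.closed_of_finiteDimensional.measurableSet
  rw [Measure.toSphere_apply' _ hm]
  refine mul_eq_zero_of_right _ (measure_mono_null ?_ (Measure.addHaar_submodule volume W hW))
  rintro _ ⟨t, -, _, ⟨v, hv, rfl⟩, rfl⟩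
  exact W.smul_mem t hv

theorem measurePreserving_neg_toSphere :
    MeasurePreserving (fun v : Metric.sphere (0 : E) 1 => -v)
      (volume : Measure E).toSphere (volume : Measure E).toSphere := by
  have hn : Measurable (fun v : Metric.sphere (0 : E) 1 => -v) := continuous_neg.measurable
  refine ⟨hn, Measure.ext fun s hs => ?_⟩
  rw [Measure.map_apply hn hs, Measure.toSphere_apply' _ (hn hs), Measure.toSphere_apply' _ hs,
    ← Measure.measure_neg volume]
  congr 2
  ext x
  constructor
  · rintro ⟨t, ht, _, ⟨v, hv, rfl⟩, hx⟩
    exact ⟨t, ht, _, ⟨-v, hv, rfl⟩, by simpa [neg_eq_iff_eq_neg] using hx⟩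
  · rintro ⟨t, ht, _, ⟨v, hv, rfl⟩, rfl⟩
    exact ⟨t, ht, _, ⟨-v, by simpa using hv, rfl⟩, by simp⟩

end General

variable {d : ℕ}

theorem measurableSet_upperHemisphere : MeasurableSet (upperHemisphere d) := by
  have : IsClosed (upperHemisphere d) := by
    simp only [upperHemisphere, Set.ofPred_forall]
    exact isClosed_iInter fun i => isClosed_iInter fun _ =>
      isClosed_le continuous_const (by fun_prop)
  exact this.measurableSet

/-- The hemisphere and its antipode overlap only in the equator, a null set. Even functions can
therefore be averaged over the whole sphere instead. -/
theorem compl_upperHemisphere_ae_eq (hd : 0 < d) :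
    ((upperHemisphere d)ᶜ : Set (UnitSphere d))
      =ᵐ[(volume : Measure (EuclideanSpace ℝ (Fin d))).toSphere]
      (fun v => -v) ⁻¹' upperHemisphere d := by
  set i : Fin d := ⟨d - 1, by omega⟩
  have hi : ∀ v : UnitSphere d,
      v ∈ upperHemisphere d ↔ 0 ≤ (v : EuclideanSpace ℝ (Fin d)) i := by
    intro v
    refine ⟨fun h => h i (by simp [i]; omega), fun h j hj => ?_⟩
    rwa [show j = i from Fin.ext (by simp [i]; omega)]
  let W : Submodule ℝ (EuclideanSpace ℝ (Fin d)) :=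
    LinearMap.ker (EuclideanSpace.proj i : EuclideanSpace ℝ (Fin d) →L[ℝ] ℝ).toLinearMap
  have hW : W ≠ ⊤ := by
    intro h
    have : EuclideanSpace.single i (1 : ℝ) ∈ W := h ▸ Submodule.mem_top
    simp [W] at this
  have h0 := toSphere_preimage_submodule_eq_zero hW
  have : ∀ᵐ v : UnitSphere d ∂(volume : Measure (EuclideanSpace ℝ (Fin d))).toSphere,
      (v : EuclideanSpace ℝ (Fin d)) i ≠ 0 := by
    rw [ae_iff]
    simpa [W] using h0
  filter_upwards [this] with v hv
  apply propext
  change v ∉ upperHemisphere d ↔ -v ∈ upperHemisphere d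
  rw [hi, hi]
  simp only [coe_neg_sphere, PiLp.neg_apply, not_le, Left.nonneg_neg_iff]
  exact ⟨le_of_lt, fun h => lt_of_le_of_ne h hv⟩

theorem two_mul_setLIntegral_upperHemisphere (hd : 0 < d) {f : UnitSphere d → ENNReal}
    (hf : ∀ v, f (-v) = f v) :
    2 * ∫⁻ v in upperHemisphere d, f v ∂(volume : Measure (EuclideanSpace ℝ (Fin d))).toSphere =
      ∫⁻ v, f v ∂(volume : Measure (EuclideanSpace ℝ (Fin d))).toSphere := by
  rw [← lintegral_add_compl (μ := (volume : Measure (EuclideanSpace ℝ (Fin d))).toSphere) f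
    measurableSet_upperHemisphere, setLIntegral_congr (compl_upperHemisphere_ae_eq hd), two_mul]
  congr 1
  have h := (measurePreserving_neg_toSphere (E := EuclideanSpace ℝ (Fin d))).setLIntegral_comp_emb
    (Homeomorph.neg _).measurableEmbedding f ((fun v => -v) ⁻¹' upperHemisphere d)
  simp only [hf] at h
  rw [h]
  congr 2
  ext v
  simp

theorem toSphere_univ :
    (volume : Measure (EuclideanSpace ℝ (Fin d))).toSphere Set.univ
      = ENNReal.ofReal (d * kappa d) := by
  rcases Nat.eq_zero_or_pos d with rfl | hd
  · simp [Measure.toSphere_apply_univ]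
  · have : Nonempty (Fin d) := Fin.pos_iff_nonempty.mp hd
    rw [← ofReal_measureReal, Measure.toSphere_real_apply_univ, volume_real_ball_one]
    simp

theorem lintegral_uniformHemisphere (hd : 0 < d) {f : UnitSphere d → ENNReal}
    (hf : ∀ v, f (-v) = f v) :
    ∫⁻ v, f v ∂uniformHemisphere d = (ENNReal.ofReal (d * kappa d))⁻¹ *
      ∫⁻ v, f v ∂(volume : Measure (EuclideanSpace ℝ (Fin d))).toSphere := by
  have h1 := two_mul_setLIntegral_upperHemisphere hd (f := fun _ => 1) (fun _ => rfl)
  simp only [lintegral_one, Measure.restrict_apply_univ] at h1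
  rw [uniformHemisphere, ProbabilityTheory.cond, lintegral_smul_measure,
    ← two_mul_setLIntegral_upperHemisphere hd hf, ← toSphere_univ, ← h1, smul_eq_mul,
    ENNReal.mul_inv (by simp) (by simp), mul_comm 2⁻¹, mul_assoc, ← mul_assoc 2⁻¹,
    ENNReal.inv_mul_cancel (by simp) (by simp), one_mul]

theorem isProbabilityMeasure_uniformHemisphere (hd : 0 < d) :
    IsProbabilityMeasure (uniformHemisphere d) := by
  refine ⟨?_⟩
  have h := lintegral_uniformHemisphere hd (f := fun _ => 1) (fun _ => rfl)
  have hp : 0 < (d : ℝ) * kappa d := mul_pos (by exact_mod_cast hd) (kappa_pos d)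
  rwa [lintegral_one, lintegral_one, toSphere_univ, ENNReal.inv_mul_cancel (ENNReal.ofReal_pos.2 hp).ne'
    ENNReal.ofReal_ne_top] at h

theorem uniformHemisphere_preimage_submodule_eq_zero
    {W : Submodule ℝ (EuclideanSpace ℝ (Fin d))} (hW : W ≠ ⊤) :
    uniformHemisphere d {v | (v : EuclideanSpace ℝ (Fin d)) ∈ W} = 0 :=
  cond_absolutelyContinuous (toSphere_preimage_submodule_eq_zero hW)

theorem lintegral_norm_projection_uniformHemisphere
    (L : Submodule ℝ (EuclideanSpace ℝ (Fin d))) {j : ℕ} (hj : Module.finrank ℝ L = j + 1) :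
    ∫⁻ v, ENNReal.ofReal ‖L.orthogonalProjectionOnto (v : EuclideanSpace ℝ (Fin d))‖
        ∂uniformHemisphere d =
      ENNReal.ofReal (kappa (d - 1) / (d * kappa d) * ((j + 1) * kappa (j + 1) / kappa j)) := by
  have hd : 0 < d := by
    have := L.finrank_le
    simp at this
    omega
  have hp : 0 < (d : ℝ) * kappa d := mul_pos (by exact_mod_cast hd) (kappa_pos d)
  have hm : Continuous fun v : UnitSphere d =>
    ‖L.orthogonalProjectionOnto (v : EuclideanSpace ℝ (Fin d))‖ := by fun_prop
  rw [lintegral_uniformHemisphere hd (by simp), ← ofReal_integral_eq_lintegral_ofReal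
    (hm.integrable_of_hasCompactSupport (HasCompactSupport.of_compactSpace _))
    (Filter.Eventually.of_forall fun _ => norm_nonneg _),
    integral_norm_projection_toSphere_eq L hj, ← ENNReal.ofReal_inv_of_pos hp,
    ← ENNReal.ofReal_mul (by positivity)]
  congr 1
  simp
  ring

end Hemisphere

/-! ### Flats, their weights, and sections by a hyperplane. -/

section

section Weight

variable {E : Type*} [NormedAddCommGroup E] [InnerProductSpace ℝ E]

/-- The `b`-th power of the radius of the section of the ball of radius `r` by a flat whose squared
distance from the centre is `q`, and `0` if the flat misses the ball. -/
noncomputable def radial (r : ℝ) (b : ℕ) (q : ℝ) : ℝ :=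
  if q ≤ r ^ 2 then √(r ^ 2 - q) ^ b else 0

theorem radial_nonneg (r : ℝ) (b : ℕ) (q : ℝ) : 0 ≤ radial r b q := by
  unfold radial; split_ifs <;> positivity

/-- The `b`-th power of the radius of the section of the ball of radius `r` about the origin by the
flat `F`, and `0` if `F` misses the ball. -/
noncomputable def ballWeight (r : ℝ) (b : ℕ) (F : Set E) : ENNReal :=
  if Metric.infEDist 0 F ≤ ENNReal.ofReal r then
    ENNReal.ofReal (√(r ^ 2 - (Metric.infEDist 0 F).toReal ^ 2) ^ b) else 0

/-- `F` is a flat of dimension `j`, given by its direction and its point nearest to the origin. -/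
def IsFlat (j : ℕ) (F : Set E) : Prop :=
  ∃ (L : Submodule ℝ E) (c : E), c ∈ Lᗮ ∧ Module.finrank ℝ L = j ∧ F = {y | y - c ∈ L}

theorem infEDist_flat {L : Submodule ℝ E} {c : E} (hc : c ∈ Lᗮ) :
    Metric.infEDist 0 {y | y - c ∈ L} = ENNReal.ofReal ‖c‖ := by
  apply le_antisymm
  · refine (Metric.infEDist_le_edist_of_mem (y := c) (by simp)).trans ?_
    rw [edist_dist, dist_zero_left]
  · refine Metric.le_infEDist.2 fun y hy => ?_
    rw [edist_dist, dist_zero_left]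
    apply ENNReal.ofReal_le_ofReal
    have h : ‖y‖ ^ 2 = ‖c‖ ^ 2 + ‖y - c‖ ^ 2 := by
      have := norm_add_sq_eq_norm_sq_add_norm_sq_real (Submodule.inner_left_of_mem_orthogonal hy hc)
      rw [add_sub_cancel] at this
      nlinarith
    exact (sq_le_sq₀ (norm_nonneg _) (norm_nonneg _)).1 (by nlinarith [sq_nonneg ‖y - c‖])

theorem ballWeight_flat {r : ℝ} (hr : 0 ≤ r) (b : ℕ) {L : Submodule ℝ E} {c : E} (hc : c ∈ Lᗮ) :
    ballWeight r b {y | y - c ∈ L} = ENNReal.ofReal (radial r b (‖c‖ ^ 2)) := by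
  have h : ENNReal.ofReal ‖c‖ ≤ ENNReal.ofReal r ↔ ‖c‖ ^ 2 ≤ r ^ 2 := by
    rw [ENNReal.ofReal_le_ofReal_iff hr, sq_le_sq₀ (norm_nonneg _) hr]
  simp only [ballWeight, infEDist_flat hc, radial, h, ENNReal.toReal_ofReal (norm_nonneg _)]
  split_ifs <;> simp

/-- Merges the two conditional means into one weight of the shared hyperplane. -/
theorem ballWeight_mul {V : Type*} [NormedAddCommGroup V] (r : ℝ) (a b : ℕ) (F : Set V) :
    ballWeight r a F * ballWeight r b F = ballWeight r (a + b) F := by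
  unfold ballWeight
  split_ifs
  · rw [← ENNReal.ofReal_mul (by positivity), pow_add]
  · simp

theorem ballWeight_univ {r : ℝ} (hr : 0 ≤ r) (b : ℕ) :
    ballWeight r b (Set.univ : Set E) = ENNReal.ofReal (r ^ b) := by
  have h : (Set.univ : Set E) = {y | y - 0 ∈ (⊤ : Submodule ℝ E)} := by simp
  rw [h, ballWeight_flat hr b (Submodule.zero_mem _), radial, if_pos (by simp; positivity)]
  simp [Real.sqrt_sq hr]

theorem isFlat_univ : IsFlat (Module.finrank ℝ E) (Set.univ : Set E) :=
  ⟨⊤, 0, Submodule.zero_mem _, finrank_top ℝ E, by simp⟩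

theorem isClosed_flat [FiniteDimensional ℝ E] (L : Submodule ℝ E) (c : E) :
    IsClosed {y | y - c ∈ L} :=
  L.closed_of_finiteDimensional.preimage (by fun_prop)

variable [FiniteDimensional ℝ E]

theorem infEDist_le_ofReal_iff {F : Set E} (hF : IsClosed F) {s : ℝ} (hs : 0 ≤ s) :
    Metric.infEDist 0 F ≤ ENNReal.ofReal s ↔ (F ∩ Metric.closedBall 0 s).Nonempty := by
  constructor
  · intro h
    have hne : F.Nonempty := by
      by_contra hne
      rw [Set.not_nonempty_iff_eq_empty.1 hne, Metric.infEDist_empty] at h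
      simp at h
    obtain ⟨y, hy, hd⟩ := hF.exists_infDist_eq_dist hne 0
    refine ⟨y, hy, ?_⟩
    rw [mem_closedBall_zero_iff, ← dist_zero_left, ← hd]
    exact ENNReal.toReal_le_of_le_ofReal hs h
  · rintro ⟨y, hy, hb⟩
    refine (Metric.infEDist_le_edist_of_mem hy).trans ?_
    rw [edist_dist, dist_zero_left]
    exact ENNReal.ofReal_le_ofReal (mem_closedBall_zero_iff.1 hb)

/-- A sublevel set at a finite level `s` is the projection of a closed set along the compact ball of
radius `s`, hence closed. -/
theorem measurable_infEDist_section {T : Type*} [TopologicalSpace T] [MeasurableSpace T]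
    [OpensMeasurableSpace T] {R : Set (T × E)} (hR : IsClosed R) :
    Measurable fun t => Metric.infEDist (0 : E) {y | (t, y) ∈ R} := by
  refine measurable_of_Iic fun s => ?_
  by_cases hs : s = ⊤
  · simp [hs]
  obtain ⟨s, hs', rfl⟩ : ∃ u : ℝ, 0 ≤ u ∧ ENNReal.ofReal u = s :=
    ⟨s.toReal, ENNReal.toReal_nonneg, ENNReal.ofReal_toReal hs⟩
  have hc : CompactSpace (Metric.closedBall (0 : E) s) :=
    isCompact_iff_compactSpace.1 (isCompact_closedBall _ _)
  have h1 : IsClosed ((fun z : T × Metric.closedBall (0 : E) s => (z.1, (z.2 : E))) ⁻¹' R) :=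
    hR.preimage (by fun_prop)
  have h2 := isClosedMap_fst_of_compactSpace _ h1
  convert h2.measurableSet using 1
  ext t
  have hF : IsClosed {y | (t, y) ∈ R} := hR.preimage (by fun_prop : Continuous fun y : E => (t, y))
  rw [Set.mem_preimage, Set.mem_Iic, infEDist_le_ofReal_iff hF hs']
  constructor
  · rintro ⟨y, hy, hb⟩
    exact ⟨(t, ⟨y, hb⟩), hy, rfl⟩
  · rintro ⟨⟨t, y, hb⟩, hy, rfl⟩
    exact ⟨y, hy, hb⟩

theorem measurable_ballWeight_section {T : Type*} [TopologicalSpace T] [MeasurableSpace T]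
    [OpensMeasurableSpace T] {R : Set (T × E)} (hR : IsClosed R) (r : ℝ) (b : ℕ) :
    Measurable fun t => ballWeight r b {y | (t, y) ∈ R} := by
  have h := measurable_infEDist_section hR
  unfold ballWeight
  refine Measurable.ite (measurableSet_le h measurable_const) ?_ measurable_const
  fun_prop

end Weight

variable {d : ℕ}

theorem isClosed_hyperplane_relation :
    IsClosed {z : (ℝ × UnitSphere d) × EuclideanSpace ℝ (Fin d) | z.2 ∈ hyperplane z.1} :=
  isClosed_eq (by fun_prop) (by fun_prop)

/-- On `L`, pairing with the normal `v` is pairing with its projection `w`. The section thus has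
direction `L ∩ wᗮ`, and the foot point moves along `w`, orthogonally to `c`, so squared distances
add. -/
theorem inter_hyperplane_eq {L : Submodule ℝ (EuclideanSpace ℝ (Fin d))}
    {c : EuclideanSpace ℝ (Fin d)} (x : ℝ × UnitSphere d)
    (hw : L.orthogonalProjectionOnto (x.2 : EuclideanSpace ℝ (Fin d)) ≠ 0) (hc : c ∈ Lᗮ) :
    ∃ (L' : Submodule ℝ (EuclideanSpace ℝ (Fin d))) (c' : EuclideanSpace ℝ (Fin d)),
      c' ∈ L'ᗮ ∧ 1 + Module.finrank ℝ L' = Module.finrank ℝ L ∧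
      {y | y - c ∈ L} ∩ hyperplane x = {y | y - c' ∈ L'} ∧
      ‖c'‖ ^ 2 = ‖c‖ ^ 2 + ((x.1 - inner ℝ c (x.2 : EuclideanSpace ℝ (Fin d))) /
        ‖L.orthogonalProjectionOnto (x.2 : EuclideanSpace ℝ (Fin d))‖) ^ 2 := by
  obtain ⟨p, v, hv⟩ := x
  simp only at hw ⊢
  set w : EuclideanSpace ℝ (Fin d) := ↑(L.orthogonalProjectionOnto v) with hwdef
  have hwL : w ∈ L := Submodule.coe_mem _
  have hwn : ‖L.orthogonalProjectionOnto v‖ = ‖w‖ := by simp [hwdef]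
  have hw0 : w ≠ 0 := fun h => hw (Subtype.ext h)
  have hwpos : 0 < ‖w‖ := norm_pos_iff.2 hw0
  have hinner : ∀ u ∈ L, inner ℝ u v = inner ℝ u w := by
    intro u hu
    have h := Submodule.inner_right_of_mem_orthogonal hu
      (L.sub_starProjection_mem_orthogonal v)
    rw [inner_sub_right, sub_eq_zero] at h
    simpa [hwdef] using h
  -- Chosen so that `c + t • w` satisfies the hyperplane equation, as `⟪w, v⟫ = ‖w‖ ^ 2`.
  set t : ℝ := (p - inner ℝ c v) / ‖w‖ ^ 2 with ht
  have hcw : inner ℝ c w = 0 := Submodule.inner_left_of_mem_orthogonal hwL hc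
  refine ⟨(ℝ ∙ w)ᗮ ⊓ L, c + t • w, ?_, ?_, ?_, ?_⟩
  · refine Submodule.add_mem _ (Submodule.orthogonal_le inf_le_right hc)
      (Submodule.smul_mem _ _ ?_)
    refine Submodule.orthogonal_le inf_le_left ?_
    exact Submodule.le_orthogonal_orthogonal _ (Submodule.mem_span_singleton_self w)
  · rw [← Submodule.finrank_add_inf_finrank_orthogonal
      ((Submodule.span_singleton_le_iff_mem w L).2 hwL), finrank_span_singleton hw0]
  · ext y
    simp only [Set.mem_inter_iff, Set.mem_ofPred_eq, hyperplane, Submodule.mem_inf,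
      Submodule.mem_orthogonal_singleton_iff_inner_left]
    have e : y - (c + t • w) = (y - c) - t • w := by abel
    rw [e]
    have hL : (y - c) - t • w ∈ L ↔ y - c ∈ L :=
      Submodule.sub_mem_iff_left _ (Submodule.smul_mem _ _ hwL)
    rw [hL, and_comm]
    refine and_congr_left fun hy => ?_
    rw [inner_sub_left, inner_smul_left, real_inner_self_eq_norm_sq, ← hinner _ hy, inner_sub_left,
      ht]
    simp only [conj_trivial]
    rw [div_mul_cancel₀ _ (by positivity), sub_eq_zero]
    constructor
    · intro h; rw [h]
    · intro h; linarith
  · rw [hwn, norm_add_sq_real, inner_smul_right, hcw, norm_smul, mul_pow, Real.norm_eq_abs, sq_abs,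
      ht]
    field_simp
    ring

end

/-! ### Cutting a flat by one random hyperplane. -/

section

/-- Integral of the section radius of a ball along a family of parallel sections. -/
theorem setLIntegral_radial {r : ℝ} (hr : 0 < r) (b : ℕ) {q β w : ℝ} (hq : 0 ≤ q) (hw : 0 < w)
    (hw1 : w ≤ 1)
    (hβ : β ^ 2 ≤ q * (1 - w ^ 2)) :
    ∫⁻ p in Set.Icc (-r) r, ENNReal.ofReal (radial r b (q + ((p - β) / w) ^ 2)) =
      ENNReal.ofReal (kappa (b + 1) / kappa b * w * radial r (b + 1) q) := by
  by_cases hqr : q ≤ r ^ 2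
  swap
  · have h : ∀ p, radial r b (q + ((p - β) / w) ^ 2) = 0 := fun p =>
      if_neg (by have := sq_nonneg ((p - β) / w); linarith)
    have h' : radial r (b + 1) q = 0 := if_neg hqr
    simp [h, h']
  set ρ := √(r ^ 2 - q) with hρ
  have hρ0 : 0 ≤ ρ := Real.sqrt_nonneg _
  have hρ2 : ρ ^ 2 = r ^ 2 - q := Real.sq_sqrt (by linarith)
  -- By Cauchy–Schwarz, every offset whose section meets the ball already lies in `[-r, r]`, so the
  -- range of `P` truncates nothing.
  have hbound : |β| + w * ρ ≤ r := by
    have hu : √(1 - w ^ 2) ^ 2 = 1 - w ^ 2 := Real.sq_sqrt (by nlinarith)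
    have hqs : √q ^ 2 = q := Real.sq_sqrt hq
    have h1 : |β| ≤ √q * √(1 - w ^ 2) := by
      rw [← Real.sqrt_mul hq]
      exact Real.abs_le_sqrt hβ
    have h2 : (√q * √(1 - w ^ 2) + w * ρ) ^ 2 ≤ r ^ 2 := by
      have h3 : (√q * √(1 - w ^ 2) + w * ρ) ^ 2 + (√q * w - √(1 - w ^ 2) * ρ) ^ 2 =
          (√q ^ 2 + ρ ^ 2) * (√(1 - w ^ 2) ^ 2 + w ^ 2) := by ring
      rw [hu, hqs, hρ2] at h3
      nlinarith [sq_nonneg (√q * w - √(1 - w ^ 2) * ρ)]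
    have h4 := (abs_le_of_sq_le_sq' h2 hr.le).2
    linarith
  have hb1 := neg_abs_le β
  have hb2 := le_abs_self β
  have hf : ∀ p, ENNReal.ofReal (radial r b (q + ((p - β) / w) ^ 2)) =
      (Set.Icc (β - w * ρ) (β + w * ρ)).indicator
        (fun p => ENNReal.ofReal (√(ρ ^ 2 - (p / w - β / w) ^ 2) ^ b)) p := by
    intro p
    have hiff : q + ((p - β) / w) ^ 2 ≤ r ^ 2 ↔ p ∈ Set.Icc (β - w * ρ) (β + w * ρ) := by
      rw [show q + ((p - β) / w) ^ 2 ≤ r ^ 2 ↔ ((p - β) / w) ^ 2 ≤ ρ ^ 2 by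
        rw [hρ2]; constructor <;> intro h <;> linarith, sq_le_sq, abs_of_nonneg hρ0, abs_le,
        le_div_iff₀ hw, div_le_iff₀ hw, Set.mem_Icc]
      constructor <;> rintro ⟨h1, h2⟩ <;> constructor <;> linarith
    by_cases hp : p ∈ Set.Icc (β - w * ρ) (β + w * ρ)
    · rw [Set.indicator_of_mem hp, radial, if_pos (hiff.2 hp), hρ2, sub_div, sub_sub]
    · rw [Set.indicator_of_notMem hp, radial, if_neg (mt hiff.1 hp), ENNReal.ofReal_zero]
  simp only [hf]
  rw [lintegral_indicator measurableSet_Icc, Measure.restrict_restrict measurableSet_Icc,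
    Set.inter_eq_self_of_subset_left (Set.Icc_subset_Icc (by linarith) (by linarith)),
    ← ofReal_integral_eq_lintegral_ofReal
      (Continuous.integrableOn_Icc (by fun_prop)) (Filter.Eventually.of_forall fun _ => by positivity),
    integral_Icc_eq_integral_Ioc, ← intervalIntegral.integral_of_le (by nlinarith),
    intervalIntegral.integral_comp_div_sub (fun t => √(ρ ^ 2 - t ^ 2) ^ b) hw.ne',
    show (β - w * ρ) / w - β / w = -ρ by field_simp; ring,
    show (β + w * ρ) / w - β / w = ρ by field_simp; ring, integral_sqrt_sq_sub_sq_pow b hρ0, radial,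
    if_pos hqr, smul_eq_mul]
  congr 1
  ring

variable {d : ℕ}

/-- The distribution of a random hyperplane hitting the ball of radius `r`. -/
noncomputable abbrev hyperplaneLaw (d : ℕ) (r : ℝ) : Measure (ℝ × UnitSphere d) :=
  (ProbabilityTheory.cond volume (Set.Icc (-r) r)).prod (uniformHemisphere d)

theorem IsFlat.isClosed {j : ℕ} {F : Set (EuclideanSpace ℝ (Fin d))} (hF : IsFlat j F) :
    IsClosed F := by
  obtain ⟨L, c, -, -, rfl⟩ := hF
  exact isClosed_flat L c

/-- The projection vanishes only for `v ∈ Lᗮ`, a proper subspace. -/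
theorem ae_projection_ne_zero {L : Submodule ℝ (EuclideanSpace ℝ (Fin d))} {j : ℕ}
    (hj : Module.finrank ℝ L = j + 1) :
    ∀ᵐ v : UnitSphere d ∂uniformHemisphere d,
      L.orthogonalProjectionOnto (v : EuclideanSpace ℝ (Fin d)) ≠ 0 := by
  have hL : Lᗮ ≠ ⊤ := by
    intro h
    rw [Submodule.orthogonal_eq_top_iff] at h
    rw [h] at hj
    simp at hj
  simpa [ae_iff, Submodule.orthogonalProjectionOnto_eq_zero_iff] using
    uniformHemisphere_preimage_submodule_eq_zero hL

theorem isProbabilityMeasure_cond_Icc {r : ℝ} (hr : 0 < r) :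
    IsProbabilityMeasure (ProbabilityTheory.cond (volume : Measure ℝ) (Set.Icc (-r) r)) :=
  cond_isProbabilityMeasure_of_finite (by simp; linarith) (by simp)

theorem ae_isFlat_inter {r : ℝ} (hr : 0 < r) {j : ℕ} {F : Set (EuclideanSpace ℝ (Fin d))}
    (hF : IsFlat (j + 1) F) :
    ∀ᵐ x ∂hyperplaneLaw d r, IsFlat j (F ∩ hyperplane x) := by
  obtain ⟨L, c, hc, hj, rfl⟩ := hF
  have := isProbabilityMeasure_cond_Icc hr
  have hd : 0 < d := by
    have := L.finrank_le
    simp at this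
    omega
  have := isProbabilityMeasure_uniformHemisphere hd
  filter_upwards [Measure.quasiMeasurePreserving_snd.ae (ae_projection_ne_zero hj)] with x hx
  obtain ⟨L', c', hc', hd', he, -⟩ := inter_hyperplane_eq x hx hc
  exact ⟨L', c', hc', by omega, he⟩

theorem measurable_ballWeight_inter_hyperplane {F : Set (EuclideanSpace ℝ (Fin d))}
    (hF : IsClosed F) (r : ℝ) (b : ℕ) :
    Measurable fun x : ℝ × UnitSphere d => ballWeight r b (F ∩ hyperplane x) := by
  have hR : IsClosed {z : (ℝ × UnitSphere d) × EuclideanSpace ℝ (Fin d) |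
      z.2 ∈ F ∧ z.2 ∈ hyperplane z.1} :=
    (hF.preimage continuous_snd).inter isClosed_hyperplane_relation
  exact measurable_ballWeight_section hR r b

/-- Mean effect of intersecting a flat with a random isotropic hyperplane. -/
theorem lintegral_ballWeight_inter_hyperplane {r : ℝ} (hr : 0 < r) (b : ℕ) {j : ℕ}
    {F : Set (EuclideanSpace ℝ (Fin d))} (hF : IsFlat (j + 1) F) :
    ∫⁻ x, ballWeight r b (F ∩ hyperplane x) ∂hyperplaneLaw d r =
      ENNReal.ofReal (kappa (d - 1) / (d * kappa d) / (2 * r) *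
        ((j + 1) * kappa (j + 1) / kappa j) * (kappa (b + 1) / kappa b)) *
        ballWeight r (b + 1) F := by
  have hm := measurable_ballWeight_inter_hyperplane hF.isClosed r b
  obtain ⟨L, c, hc, hj, rfl⟩ := hF
  have := isProbabilityMeasure_cond_Icc hr
  have hd : 0 < d := by
    have := L.finrank_le
    simp at this
    omega
  have := isProbabilityMeasure_uniformHemisphere hd
  -- The offset is integrated first, for a fixed normal `v`; only the projection length of `v` then
  -- survives.
  rw [lintegral_prod_symm _ hm.aemeasurable]
  have hv : ∀ᵐ v : UnitSphere d ∂uniformHemisphere d,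
      ∫⁻ p, ballWeight r b ({y | y - c ∈ L} ∩ hyperplane (p, v))
        ∂(ProbabilityTheory.cond volume (Set.Icc (-r) r)) =
      ENNReal.ofReal (kappa (b + 1) / kappa b / (2 * r) * radial r (b + 1) (‖c‖ ^ 2)) *
        ENNReal.ofReal ‖L.orthogonalProjectionOnto (v : EuclideanSpace ℝ (Fin d))‖ := by
    filter_upwards [ae_projection_ne_zero hj] with v hv
    have hp : ∀ p, ballWeight r b ({y | y - c ∈ L} ∩ hyperplane (p, v)) =
        ENNReal.ofReal (radial r b (‖c‖ ^ 2 + ((p - inner ℝ c (v : EuclideanSpace ℝ (Fin d))) /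
        ‖L.orthogonalProjectionOnto (v : EuclideanSpace ℝ (Fin d))‖) ^ 2)) := by
      intro p
      obtain ⟨L', c', hc', -, he, hn⟩ := inter_hyperplane_eq (p, v) hv hc
      rw [he, ballWeight_flat hr.le b hc', hn]
    have hvn : ‖(v : EuclideanSpace ℝ (Fin d))‖ = 1 := by simp
    have hpyth := L.norm_sq_eq_add_norm_sq_projection (v : EuclideanSpace ℝ (Fin d))
    rw [hvn, one_pow] at hpyth
    have hw1 : ‖L.orthogonalProjectionOnto (v : EuclideanSpace ℝ (Fin d))‖ ≤ 1 := by
      nlinarith [norm_nonneg (L.orthogonalProjectionOnto (v : EuclideanSpace ℝ (Fin d))),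
        sq_nonneg ‖Lᗮ.orthogonalProjectionOnto (v : EuclideanSpace ℝ (Fin d))‖]
    -- Since `c ⟂ L`, only the component of `v` in `Lᗮ` pairs with `c`, and its squared norm is one
    -- minus that of the projection onto `L`.
    have hβ : (inner ℝ c (v : EuclideanSpace ℝ (Fin d))) ^ 2 ≤
        ‖c‖ ^ 2 * (1 - ‖L.orthogonalProjectionOnto (v : EuclideanSpace ℝ (Fin d))‖ ^ 2) := by
      have h1 : inner ℝ c (v : EuclideanSpace ℝ (Fin d)) =
          inner ℝ c (Lᗮ.orthogonalProjectionOnto (v : EuclideanSpace ℝ (Fin d)) :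
            EuclideanSpace ℝ (Fin d)) := by
        have h2 := Submodule.inner_left_of_mem_orthogonal (L.starProjection_apply_mem v) hc
        have h3 := L.starProjection_add_starProjection_orthogonal (v : EuclideanSpace ℝ (Fin d))
        rw [Submodule.coe_orthogonalProjectionOnto_apply]
        nth_rewrite 1 [← h3]
        rw [inner_add_right, h2, zero_add]
      rw [h1, show 1 - ‖L.orthogonalProjectionOnto (v : EuclideanSpace ℝ (Fin d))‖ ^ 2 =
        ‖Lᗮ.orthogonalProjectionOnto (v : EuclideanSpace ℝ (Fin d))‖ ^ 2 by linarith, ← mul_pow,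
        ← sq_abs]
      exact pow_le_pow_left₀ (abs_nonneg _) (abs_real_inner_le_norm _ _) 2
    simp only [hp]
    rw [ProbabilityTheory.cond, lintegral_smul_measure, setLIntegral_radial hr b (by positivity)
      (norm_pos_iff.2 hv) hw1 hβ, Real.volume_Icc, smul_eq_mul, ← ENNReal.ofReal_inv_of_pos (by linarith),
      ← ENNReal.ofReal_mul (by simp; linarith), ← ENNReal.ofReal_mul]
    · congr 1
      field_simp
      ring
    · have := radial_nonneg r (b + 1) (‖c‖ ^ 2)
      have := kappa_pos b
      have := kappa_pos (b + 1)
      positivity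
  rw [lintegral_congr_ae hv, lintegral_const_mul _ (by fun_prop),
    lintegral_norm_projection_uniformHemisphere L hj, ballWeight_flat hr.le _ hc,
    ← ENNReal.ofReal_mul, ← ENNReal.ofReal_mul]
  · congr 1
    ring
  all_goals
    have := radial_nonneg r (b + 1) (‖c‖ ^ 2)
    have := kappa_pos b
    have := kappa_pos (b + 1)
    have := kappa_pos j
    have := kappa_pos (j + 1)
    have := kappa_pos d
    have := kappa_pos (d - 1)
    positivity

end

/-! ### Independence, volumes of sections, and joint measurability. -/

section

theorem lintegral_prodMk_of_indepFun {Ω α β : Type*} {mΩ : MeasurableSpace Ω}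
    [MeasurableSpace α] [MeasurableSpace β] {P : Measure Ω} [IsFiniteMeasure P]
    {Y : Ω → α} {Z : Ω → β} (h : IndepFun Y Z P) (hY : AEMeasurable Y P) (hZ : AEMeasurable Z P)
    {f : α × β → ENNReal} (hf : Measurable f) :
    ∫⁻ ω, f (Y ω, Z ω) ∂P = ∫⁻ y, ∫⁻ ω, f (y, Z ω) ∂P ∂(P.map Y) := by
  have h1 : ∫⁻ ω, f (Y ω, Z ω) ∂P = ∫⁻ z, f z ∂(P.map fun ω => (Y ω, Z ω)) :=
    (lintegral_map' hf.aemeasurable (hY.prodMk hZ)).symm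
  rw [h1, (indepFun_iff_map_prod_eq_prod_map_map hY hZ).1 h, lintegral_prod _ hf.aemeasurable]
  refine lintegral_congr fun y => ?_
  rw [lintegral_map' (by fun_prop) hZ]

theorem ae_prodMk_of_indepFun {Ω α β : Type*} {mΩ : MeasurableSpace Ω}
    [MeasurableSpace α] [MeasurableSpace β] {P : Measure Ω} [IsFiniteMeasure P]
    {Y : Ω → α} {Z : Ω → β} (h : IndepFun Y Z P) (hY : AEMeasurable Y P) (hZ : AEMeasurable Z P)
    {p : α × β → Prop} (hp : MeasurableSet {z | p z})
    (hae : ∀ᵐ y ∂(P.map Y), ∀ᵐ z ∂(P.map Z), p (y, z)) :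
    ∀ᵐ ω ∂P, p (Y ω, Z ω) := by
  refine ae_of_ae_map (hY.prodMk hZ) (p := p) ?_
  rw [(indepFun_iff_map_prod_eq_prod_map_map hY hZ).1 h]
  exact (Measure.ae_prod_iff_ae_ae hp).2 hae

section Volume

variable {E : Type*} [NormedAddCommGroup E] [InnerProductSpace ℝ E] [FiniteDimensional ℝ E]
  [MeasurableSpace E] [BorelSpace E]

/-- By Pythagoras the section is an isometric copy of a ball in `L` of radius `√(r² - ‖c‖²)`, or
empty. -/
theorem euclideanHausdorffMeasure_flat_inter_closedBall {r : ℝ} (hr : 0 ≤ r) {k : ℕ} {F : Set E}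
    (hF : IsFlat k F) :
    Measure.euclideanHausdorffMeasure k (F ∩ Metric.closedBall 0 r) =
      ENNReal.ofReal (kappa k) * ballWeight r k F := by
  obtain ⟨L, c, hc, hk, rfl⟩ := hF
  rw [ballWeight_flat hr _ hc, radial]
  have hy : ∀ u : L, ‖c + u‖ ^ 2 = ‖c‖ ^ 2 + ‖u‖ ^ 2 := by
    intro u
    rw [norm_add_sq_real, Submodule.inner_left_of_mem_orthogonal u.2 hc, mul_zero, add_zero]
    rfl
  have himage : {y | y - c ∈ L} = Set.range fun u : L => c + (u : E) := by
    ext y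
    constructor
    · intro h
      exact ⟨⟨y - c, h⟩, by simp⟩
    · rintro ⟨u, rfl⟩
      simp
  split_ifs with h
  · have he : {y | y - c ∈ L} ∩ Metric.closedBall 0 r =
        (fun u : L => c + (u : E)) '' Metric.closedBall 0 (√(r ^ 2 - ‖c‖ ^ 2)) := by
      rw [himage, ← Set.image_univ, ← Set.image_inter_preimage, Set.univ_inter]
      congr 1
      ext u
      rw [Set.mem_preimage, mem_closedBall_zero_iff, mem_closedBall_zero_iff,
        ← sq_le_sq₀ (norm_nonneg _) hr, hy, Real.le_sqrt (norm_nonneg _) (by linarith)]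
      constructor <;> intro h <;> linarith
    have hiso : Isometry fun u : L => c + (u : E) :=
      (isometry_add_left c).comp isometry_subtype_coe
    rw [he, hiso.euclideanHausdorffMeasure_image, ← hk,
      InnerProductSpace.euclideanHausdorffMeasure_eq_volume,
      volume_closedBall_eq_kappa _ (Real.sqrt_nonneg _), ENNReal.ofReal_mul (kappa_pos _).le]
  · have he : {y | y - c ∈ L} ∩ Metric.closedBall 0 r = ∅ := by
      rw [himage, Set.eq_empty_iff_forall_notMem]
      rintro _ ⟨⟨u, rfl⟩, hb⟩
      rw [mem_closedBall_zero_iff, ← sq_le_sq₀ (norm_nonneg _) hr] at hb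
      simp only [hy] at hb
      nlinarith [sq_nonneg ‖u‖]
    simp [he]

end Volume

variable {d : ℕ}

/-- The solutions form a translate of `Wᗮ`, with `W` the span of the normals; independence makes
`dim W` equal to `S.card`. -/
theorem isFlat_iInter_hyperplane {S : Finset ℕ} {k : ℕ} (hk : S.card + k = d)
    {x : ℕ → ℝ × UnitSphere d}
    (hli : LinearIndepOn ℝ (fun i => ((x i).2 : EuclideanSpace ℝ (Fin d))) (S : Set ℕ))
    (hne : (⋂ i ∈ S, hyperplane (x i)).Nonempty) :
    IsFlat k (⋂ i ∈ S, hyperplane (x i)) := by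
  obtain ⟨y₀, hy₀⟩ := hne
  set W := Submodule.span ℝ
    ((fun i => ((x i).2 : EuclideanSpace ℝ (Fin d))) '' (S : Set ℕ)) with hW
  refine ⟨Wᗮ, y₀ - Wᗮ.starProjection y₀, Wᗮ.sub_starProjection_mem_orthogonal y₀, ?_, ?_⟩
  · have h1 := W.finrank_add_finrank_orthogonal
    have h2 : Module.finrank ℝ W = S.card := by
      have := finrank_span_eq_card hli
      rw [hW, Set.image_eq_range]
      simpa using this
    rw [finrank_euclideanSpace_fin] at h1
    omega
  · ext y
    have e : y - (y₀ - Wᗮ.starProjection y₀) = (y - y₀) + Wᗮ.starProjection y₀ := by abel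
    rw [Set.mem_ofPred_eq, e, Wᗮ.add_mem_iff_left (Wᗮ.starProjection_apply_mem y₀)]
    simp only [Set.mem_iInter, hyperplane, Set.mem_ofPred_eq] at hy₀ ⊢
    rw [hW, Submodule.mem_orthogonal']
    constructor
    · intro h u hu
      induction hu using Submodule.span_induction with
      | mem u hu =>
        obtain ⟨i, hi, rfl⟩ := hu
        rw [inner_sub_left, h i hi, hy₀ i hi, sub_self]
      | zero => simp
      | add u v _ _ hu hv => rw [inner_add_right, hu, hv, add_zero]
      | smul t u _ hu => rw [inner_smul_right, hu, mul_zero]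
    · intro h i hi
      have := h _ (Submodule.subset_span ⟨i, hi, rfl⟩)
      rw [inner_sub_left, hy₀ i hi, sub_eq_zero] at this
      exact this

theorem measurable_ballWeight_iInter_comp {ι T : Type*} [TopologicalSpace T] [MeasurableSpace T]
    [OpensMeasurableSpace T] {F : Set (EuclideanSpace ℝ (Fin d))} (hF : IsClosed F)
    {f : ι → T → ℝ × UnitSphere d} (hf : ∀ i, Continuous (f i)) (r : ℝ) (b : ℕ) :
    Measurable fun t => ballWeight r b (F ∩ ⋂ i, hyperplane (f i t)) := by
  have hR : IsClosed {z : T × EuclideanSpace ℝ (Fin d) |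
      z.2 ∈ F ∩ ⋂ i, hyperplane (f i z.1)} := by
    have : {z : T × EuclideanSpace ℝ (Fin d) | z.2 ∈ F ∩ ⋂ i, hyperplane (f i z.1)} =
        Prod.snd ⁻¹' F ∩ ⋂ i, (fun z : T × EuclideanSpace ℝ (Fin d) => (f i z.1, z.2)) ⁻¹'
          {z : (ℝ × UnitSphere d) × EuclideanSpace ℝ (Fin d) | z.2 ∈ hyperplane z.1} := by
      ext z; simp
    rw [this]
    refine (hF.preimage continuous_snd).inter (isClosed_iInter fun i =>
      isClosed_hyperplane_relation.preimage ?_)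
    exact ((hf i).comp continuous_fst).prodMk continuous_snd
  exact measurable_ballWeight_section hR r b

theorem measurable_ballWeight_iInter {ι : Type*} [Countable ι]
    {F : Set (EuclideanSpace ℝ (Fin d))} (hF : IsClosed F) (r : ℝ) (b : ℕ) :
    Measurable fun x : ι → ℝ × UnitSphere d =>
      ballWeight r b (F ∩ ⋂ i, hyperplane (x i)) :=
  measurable_ballWeight_iInter_comp hF (fun i => continuous_apply i) r b

/-- The map `g` lets two subfamilies be read off one common tuple, as needed for a product of
weights. `Option ι` adjoins the distinguished hyperplane `z.1`. -/
theorem measurable_ballWeight_inter_iInter {ι κ : Type*} [Countable κ] (g : ι → κ)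
    {F : Set (EuclideanSpace ℝ (Fin d))} (hF : IsClosed F) (r : ℝ) (b : ℕ) :
    Measurable fun z : (ℝ × UnitSphere d) × (κ → ℝ × UnitSphere d) =>
      ballWeight r b (F ∩ hyperplane z.1 ∩ ⋂ i, hyperplane (z.2 (g i))) := by
  have hf : ∀ o : Option ι, Continuous
      fun z : (ℝ × UnitSphere d) × (κ → ℝ × UnitSphere d) => o.elim z.1 fun i => z.2 (g i) := by
    intro o
    cases o
    · exact continuous_fst
    · exact (continuous_apply _).comp continuous_snd
  simpa [Set.iInter_option, Set.inter_assoc] using measurable_ballWeight_iInter_comp hF hf r b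

end

/-! ### Several independent hyperplanes, and two flats sharing one. -/

section

variable {Ω : Type*} [MeasurableSpace Ω] {P : Measure Ω} {d : ℕ} {r : ℝ}
  {X : ℕ → Ω → ℝ × UnitSphere d}

theorem biInter_hyperplane_eq_iInter (S : Finset ℕ) (x : ℕ → ℝ × UnitSphere d) :
    ⋂ i ∈ S, hyperplane (x i) = ⋂ i : S, hyperplane (x i) :=
  Set.biInter_eq_iInter (S : Set ℕ) fun i _ => hyperplane (x i)

section Indep

variable {α : Type*} [MeasurableSpace α] {Y : ℕ → Ω → α}

theorem indepFun_apply_finset (h : iIndepFun Y P) (hY : ∀ i, AEMeasurable (Y i) P) {i : ℕ}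
    {S : Finset ℕ} (hi : i ∉ S) : IndepFun (Y i) (fun ω (j : S) => Y j ω) P := by
  have h1 := h.indepFun_finset₀ {i} S (by simpa using hi) hY
  exact h1.comp (measurable_pi_apply (⟨i, by simp⟩ : ({i} : Finset ℕ))) measurable_id

theorem aemeasurable_finset_tuple (hY : ∀ i, AEMeasurable (Y i) P) (S : Finset ℕ) :
    AEMeasurable (fun ω (j : S) => Y j ω) P :=
  aemeasurable_pi_lambda _ fun j => hY j

end Indep

namespace IsHyperplaneSample

variable (hX : IsHyperplaneSample P r (uniformHemisphere d) X)
include hX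

theorem aemeasurable (i : ℕ) : AEMeasurable (X i) P := (hX.law i).aemeasurable

theorem aemeasurable_ballWeight {F : Set (EuclideanSpace ℝ (Fin d))} (hF : IsClosed F)
    (b : ℕ) (S : Finset ℕ) :
    AEMeasurable (fun ω => ballWeight r b (F ∩ ⋂ i ∈ S, hyperplane (X i ω))) P := by
  simp only [biInter_hyperplane_eq_iInter]
  exact (measurable_ballWeight_iInter hF r b).comp_aemeasurable
    (aemeasurable_finset_tuple hX.aemeasurable S)

variable [IsProbabilityMeasure P]

/-- Mean effect of intersecting a flat with finitely many independent random hyperplanes. -/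
theorem lintegral_ballWeight_inter (hr : 0 < r) (a k : ℕ) (S : Finset ℕ)
    {F : Set (EuclideanSpace ℝ (Fin d))} (hF : IsFlat (k + S.card) F) :
    ∫⁻ ω, ballWeight r a (F ∩ ⋂ i ∈ S, hyperplane (X i ω)) ∂P =
      ENNReal.ofReal ((kappa (d - 1) / (d * kappa d) / (2 * r)) ^ S.card *
        (((k + S.card)! : ℝ) * kappa (k + S.card) / ((k ! : ℝ) * kappa k)) *
        (kappa (a + S.card) / kappa a)) * ballWeight r (a + S.card) F := by
  induction S using Finset.induction_on generalizing F with
  | empty =>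
    have h1 := kappa_pos a
    have h2 := kappa_pos k
    have h3 : (k ! : ℝ) ≠ 0 := by positivity
    simp [div_self h1.ne', div_self (mul_ne_zero h3 h2.ne')]
  | insert i S hi ih =>
    rw [Finset.card_insert_of_notMem hi, ← add_assoc] at hF
    rw [Finset.card_insert_of_notMem hi]
    have h1 := lintegral_prodMk_of_indepFun (indepFun_apply_finset hX.indep hX.aemeasurable hi)
      (hX.aemeasurable i) (aemeasurable_finset_tuple hX.aemeasurable S)
      (measurable_ballWeight_inter_iInter (id : S → S) hF.isClosed r a)
    rw [(hX.law i).map_eq] at h1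
    dsimp only [id] at h1
    simp only [biInter_hyperplane_eq_iInter S] at ih
    simp only [Finset.set_biInter_insert, ← Set.inter_assoc, biInter_hyperplane_eq_iInter S]
    rw [h1]
    -- With `X i` frozen at `x`, the induction hypothesis applies to `F ∩ hyperplane x`, almost
    -- surely a flat of one dimension less.
    have h2 : ∀ᵐ x ∂hyperplaneLaw d r,
        ∫⁻ ω, ballWeight r a (F ∩ hyperplane x ∩ ⋂ i : S, hyperplane (X i ω)) ∂P =
        ENNReal.ofReal ((kappa (d - 1) / (d * kappa d) / (2 * r)) ^ S.card *
          (((k + S.card)! : ℝ) * kappa (k + S.card) / ((k ! : ℝ) * kappa k)) *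
          (kappa (a + S.card) / kappa a)) * ballWeight r (a + S.card) (F ∩ hyperplane x) := by
      filter_upwards [ae_isFlat_inter hr hF] with x hx using ih hx
    rw [lintegral_congr_ae h2, lintegral_const_mul _
      (measurable_ballWeight_inter_hyperplane hF.isClosed r _),
      lintegral_ballWeight_inter_hyperplane hr _ hF, ← mul_assoc, ← ENNReal.ofReal_mul]
    · congr 2
      generalize kappa (d - 1) / (d * kappa d) / (2 * r) = q
      have := kappa_pos (k + S.card)
      have := kappa_pos (a + S.card)
      rw [← add_assoc, ← add_assoc, Nat.factorial_succ]
      push_cast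
      field_simp
      ring
    · have := kappa_pos (k + S.card)
      have := kappa_pos (a + S.card)
      have := kappa_pos k
      have := kappa_pos a
      have := kappa_pos d
      have := kappa_pos (d - 1)
      positivity

/-- A new normal, independent of the earlier ones, almost surely avoids their span, which is proper
as long as there are fewer than `d` of them. Openness of linear independence supplies measurability.
-/
theorem ae_linearIndepOn (S : Finset ℕ) (hr : 0 < r) (hS : S.card ≤ d) :
    ∀ᵐ ω ∂P, LinearIndepOn ℝ (fun i => ((X i ω).2 : EuclideanSpace ℝ (Fin d))) (S : Set ℕ) := by
  induction S using Finset.induction_on with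
  | empty => simp
  | insert i S hi ih =>
    rw [Finset.card_insert_of_notMem hi] at hS
    have hd : 0 < d := by omega
    have := isProbabilityMeasure_cond_Icc hr
    have := isProbabilityMeasure_uniformHemisphere hd
    have ih := ih (by omega)
    have hopen : IsOpen {z : (S → ℝ × UnitSphere d) × (ℝ × UnitSphere d) |
        LinearIndependent ℝ fun o : Option S => o.elim (z.2.2 : EuclideanSpace ℝ (Fin d))
          fun j => ((z.1 j).2 : EuclideanSpace ℝ (Fin d))} := by
      refine isOpen_setOfPred_linearIndependent.preimage (continuous_pi fun o => ?_)
      cases o <;> simp only [Option.elim] <;> fun_prop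
    have hopen' : IsOpen {x : S → ℝ × UnitSphere d |
        LinearIndependent ℝ fun j => ((x j).2 : EuclideanSpace ℝ (Fin d))} :=
      isOpen_setOfPred_linearIndependent.preimage (by fun_prop)
    have hmap : ∀ᵐ x ∂(P.map fun ω (j : S) => X j ω),
        LinearIndependent ℝ fun j => ((x j).2 : EuclideanSpace ℝ (Fin d)) :=
      (ae_map_iff (aemeasurable_finset_tuple hX.aemeasurable S) hopen'.measurableSet).2 ih
    have h := ae_prodMk_of_indepFun (indepFun_apply_finset hX.indep hX.aemeasurable hi).symm
      (aemeasurable_finset_tuple hX.aemeasurable S) (hX.aemeasurable i) hopen.measurableSet (by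
        filter_upwards [hmap] with x hx
        rw [(hX.law i).map_eq]
        have hW : Submodule.span ℝ (Set.range fun j : S =>
            ((x j).2 : EuclideanSpace ℝ (Fin d))) ≠ ⊤ := by
          intro hW
          have h1 := finrank_span_eq_card hx
          rw [hW, finrank_top, finrank_euclideanSpace_fin, Fintype.card_coe] at h1
          omega
        have hv : ∀ᵐ v : UnitSphere d ∂uniformHemisphere d, (v : EuclideanSpace ℝ (Fin d)) ∉
            Submodule.span ℝ (Set.range fun j : S =>
              ((x j).2 : EuclideanSpace ℝ (Fin d))) := by
          simpa [ae_iff] using uniformHemisphere_preimage_submodule_eq_zero hW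
        filter_upwards [Measure.quasiMeasurePreserving_snd.ae hv] with y hy
        have := linearIndependent_option'.2 ⟨hx, hy⟩
        convert! this using 2 with o
        cases o <;> rfl)
    filter_upwards [h, ih] with ω hω hωS
    rw [Finset.coe_insert, linearIndepOn_insert (by simpa using hi)]
    refine ⟨hωS, ?_⟩
    have h2 : LinearIndependent ℝ fun o : Option S =>
      Option.casesOn' o ((X i ω).2 : EuclideanSpace ℝ (Fin d))
        fun j : S => ((X j ω).2 : EuclideanSpace ℝ (Fin d)) := by
      convert! hω using 2 with o
      cases o <;> rfl
    have h3 := (linearIndependent_option'.1 h2).2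
    rwa [Set.image_eq_range]

theorem ae_euclideanHausdorffMeasure_flatInBall (hr : 0 < r) {k : ℕ} {S : Finset ℕ}
    (hS : S.card + k = d) :
    ∀ᵐ ω ∂P, Measure.euclideanHausdorffMeasure k (flatInBall r (fun i => X i ω) S) =
      ENNReal.ofReal (kappa k) * ballWeight r k (⋂ i ∈ S, hyperplane (X i ω)) := by
  filter_upwards [hX.ae_linearIndepOn S hr (by omega)] with ω hω
  by_cases hne : (⋂ i ∈ S, hyperplane (X i ω)).Nonempty
  · exact euclideanHausdorffMeasure_flat_inter_closedBall hr.le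
      (isFlat_iInter_hyperplane hS hω hne)
  -- The distance to the empty set is `⊤`, so the weight vanishes together with the volume.
  · rw [flatInBall, Set.not_nonempty_iff_eq_empty.1 hne]
    simp [ballWeight]

/-- Mixed second moment of the section weights of two flats that share one hyperplane. -/
theorem lintegral_ballWeight_mul (hr : 0 < r) (a b : ℕ) {k l : ℕ} (hk : k < d) (hl : l < d) :
    ∫⁻ ω, ballWeight r a (⋂ i ∈ Finset.range (d - k), hyperplane (X i ω)) *
        ballWeight r b (⋂ i ∈ Finset.Ico (d - k - 1) (2 * d - k - l - 1), hyperplane (X i ω)) ∂P =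
      ENNReal.ofReal (((kappa (d - 1) / (d * kappa d) / (2 * r)) ^ (d - k - 1) *
        (((d - 1)! : ℝ) * kappa (d - 1) / ((k ! : ℝ) * kappa k)) *
        (kappa (a + (d - k - 1)) / kappa a)) *
        ((kappa (d - 1) / (d * kappa d) / (2 * r)) ^ (d - l - 1) *
        (((d - 1)! : ℝ) * kappa (d - 1) / ((l ! : ℝ) * kappa l)) *
        (kappa (b + (d - l - 1)) / kappa b)) *
        (kappa (a + (d - k - 1) + (b + (d - l - 1)) + 1) /
          kappa (a + (d - k - 1) + (b + (d - l - 1))) / (2 * r) *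
          r ^ (a + (d - k - 1) + (b + (d - l - 1)) + 1))) := by
  -- The zero-based index of the shared hyperplane; `S` and `T` index the others in each family.
  set i₀ := d - k - 1 with hi₀
  set S := Finset.range i₀ with hS
  set T := Finset.Ico (i₀ + 1) (2 * d - k - l - 1) with hT
  have hSc : S.card = d - k - 1 := by simp [hS, hi₀]
  have hTc : T.card = d - l - 1 := by simp [hT, hi₀]; omega
  have hST : Disjoint S T := by
    rw [Finset.disjoint_left]
    intro i h1 h2
    simp [hS, hT] at h1 h2
    omega
  have hiS : i₀ ∉ S ∪ T := by simp [hS, hT]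
  have e1 : Finset.range (d - k) = insert i₀ S := by
    ext i; simp [hS]; omega
  have e2 : Finset.Ico i₀ (2 * d - k - l - 1) = insert i₀ T := by
    ext i; simp [hT]; omega
  have hdF : IsFlat d (Set.univ : Set (EuclideanSpace ℝ (Fin d))) := by
    simpa using isFlat_univ (E := EuclideanSpace ℝ (Fin d))
  have hdF' : IsFlat (d - 1 + 1) (Set.univ : Set (EuclideanSpace ℝ (Fin d))) := by
    rwa [show d - 1 + 1 = d by omega]
  have hfm : ∀ (c : ℕ) (U : Finset ℕ) (hU : U ⊆ S ∪ T),
      Measurable fun z : (ℝ × UnitSphere d) × (↥(S ∪ T) → ℝ × UnitSphere d) =>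
        ballWeight r c (Set.univ ∩ hyperplane z.1 ∩ ⋂ i : U, hyperplane (z.2 ⟨i, hU i.2⟩)) :=
    fun c U hU => measurable_ballWeight_inter_iInter (fun i : U => (⟨i, hU i.2⟩ : ↥(S ∪ T)))
      isClosed_univ r c
  have h1 := lintegral_prodMk_of_indepFun (indepFun_apply_finset hX.indep hX.aemeasurable hiS)
    (hX.aemeasurable i₀) (aemeasurable_finset_tuple hX.aemeasurable (S ∪ T))
    ((hfm a S Finset.subset_union_left).mul (hfm b T Finset.subset_union_right))
  rw [(hX.law i₀).map_eq] at h1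
  simp only [Pi.mul_apply] at h1
  -- Given the shared hyperplane, the families `S` and `T` act independently on a flat of dimension
  -- `d - 1`.
  have h2 : ∀ᵐ x ∂hyperplaneLaw d r,
      ∫⁻ ω, ballWeight r a (Set.univ ∩ hyperplane x ∩ ⋂ i : S, hyperplane (X i ω)) *
        ballWeight r b (Set.univ ∩ hyperplane x ∩ ⋂ i : T, hyperplane (X i ω)) ∂P =
      ENNReal.ofReal (((kappa (d - 1) / (d * kappa d) / (2 * r)) ^ (d - k - 1) *
        (((d - 1)! : ℝ) * kappa (d - 1) / ((k ! : ℝ) * kappa k)) *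
        (kappa (a + (d - k - 1)) / kappa a)) *
        ((kappa (d - 1) / (d * kappa d) / (2 * r)) ^ (d - l - 1) *
        (((d - 1)! : ℝ) * kappa (d - 1) / ((l ! : ℝ) * kappa l)) *
        (kappa (b + (d - l - 1)) / kappa b))) *
        ballWeight r (a + (d - k - 1) + (b + (d - l - 1))) (Set.univ ∩ hyperplane x) := by
    filter_upwards [ae_isFlat_inter hr hdF'] with x hx
    have hSi := hX.lintegral_ballWeight_inter hr a k S (F := Set.univ ∩ hyperplane x)
      (by rwa [hSc, show k + (d - k - 1) = d - 1 by omega])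
    have hTi := hX.lintegral_ballWeight_inter hr b l T (F := Set.univ ∩ hyperplane x)
      (by rwa [hTc, show l + (d - l - 1) = d - 1 by omega])
    have hSm := hX.aemeasurable_ballWeight hx.isClosed a S
    have hTm := hX.aemeasurable_ballWeight hx.isClosed b T
    simp only [biInter_hyperplane_eq_iInter] at hSi hTi hSm hTm
    have hind : IndepFun
        (fun ω => ballWeight r a (Set.univ ∩ hyperplane x ∩ ⋂ i : S, hyperplane (X i ω)))
        (fun ω => ballWeight r b (Set.univ ∩ hyperplane x ∩ ⋂ i : T, hyperplane (X i ω))) P := by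
      exact (hX.indep.indepFun_finset₀ S T hST hX.aemeasurable).comp
        (measurable_ballWeight_iInter hx.isClosed r a)
        (measurable_ballWeight_iInter hx.isClosed r b)
    rw [lintegral_mul_eq_lintegral_mul_lintegral_of_indepFun'' hSm hTm hind, hSi, hTi,
      hSc, hTc, show k + (d - k - 1) = d - 1 by omega, show l + (d - l - 1) = d - 1 by omega,
      mul_mul_mul_comm, ballWeight_mul, ← ENNReal.ofReal_mul]
    have := kappa_pos (d - 1)
    have := kappa_pos d
    have := kappa_pos k
    have := kappa_pos a
    have := kappa_pos (a + (d - k - 1))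
    positivity
  have h3 : ∀ (U : Finset ℕ) (ω : Ω), ⋂ i ∈ insert i₀ U, hyperplane (X i ω) =
      Set.univ ∩ hyperplane (X i₀ ω) ∩ ⋂ i : U, hyperplane (X i ω) := by
    intro U ω
    rw [Finset.set_biInter_insert, Set.univ_inter, biInter_hyperplane_eq_iInter]
  rw [e1, e2]
  simp only [h3]
  rw [h1, lintegral_congr_ae h2, lintegral_const_mul _
    (measurable_ballWeight_inter_hyperplane isClosed_univ r _),
    lintegral_ballWeight_inter_hyperplane hr _ hdF', ballWeight_univ hr.le, ← mul_assoc,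
    ← ENNReal.ofReal_mul, ← ENNReal.ofReal_mul]
  · congr 1
    have := kappa_pos d
    have := kappa_pos (d - 1)
    have hd0 : (d : ℝ) ≠ 0 := by
      have : 0 < d := by omega
      positivity
    have hcast : ((d - 1 : ℕ) : ℝ) + 1 = d := by
      rw [Nat.cast_sub (by omega)]; simp
    -- For the last cut the flat is all of `ℝᵈ`: unit normals have projection length one, so the
    -- angular constants cancel.
    have hstep : ∀ u v : ℝ, kappa (d - 1) / (d * kappa d) / (2 * r) *
        (d * kappa d / kappa (d - 1)) * (u / v) = u / v / (2 * r) := by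
      intro u v
      field_simp
    rw [hcast, show d - 1 + 1 = d by omega, hstep, mul_assoc]
  all_goals
    have := kappa_pos (d - 1)
    have := kappa_pos (d - 1 + 1)
    have := kappa_pos d
    have := kappa_pos k
    have := kappa_pos l
    have := kappa_pos a
    have := kappa_pos b
    have := kappa_pos (a + (d - k - 1))
    have := kappa_pos (b + (d - l - 1))
    have := kappa_pos (a + (d - k - 1) + (b + (d - l - 1)))
    have := kappa_pos (a + (d - k - 1) + (b + (d - l - 1)) + 1)
    positivity

end IsHyperplaneSample

end

/-! ### Closed forms of the moments. -/

section

variable {Ω : Type*} [MeasurableSpace Ω] {P : Measure Ω} {d : ℕ} {r : ℝ}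
  {X : ℕ → Ω → ℝ × UnitSphere d}

theorem isClosed_biInter_hyperplane (S : Finset ℕ) (x : ℕ → ℝ × UnitSphere d) :
    IsClosed (⋂ i ∈ S, hyperplane (x i)) :=
  isClosed_biInter fun i _ => isClosed_hyperplane_relation.preimage
    (by fun_prop : Continuous fun y : EuclideanSpace ℝ (Fin d) => (x i, y))

/-- At exponent `0` the weight is the indicator of meeting the ball; a tangent flat also counts,
since `0 ^ 0 = 1`. -/
theorem chi_flatInBall (hr : 0 ≤ r) (S : Finset ℕ) (x : ℕ → ℝ × UnitSphere d) :
    chi (flatInBall r x S) = (ballWeight r 0 (⋂ i ∈ S, hyperplane (x i))).toReal := by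
  have h := infEDist_le_ofReal_iff (isClosed_biInter_hyperplane S x) hr
  unfold chi ballWeight flatInBall
  by_cases hne : ((⋂ i ∈ S, hyperplane (x i)) ∩ Metric.closedBall 0 r).Nonempty
  · rw [if_pos hne, if_pos (h.2 hne)]
    simp
  · rw [if_neg hne, if_neg (mt h.1 hne)]
    simp

theorem ballWeight_ne_top {V : Type*} [NormedAddCommGroup V] (r : ℝ) (b : ℕ) (F : Set V) :
    ballWeight r b F ≠ ⊤ := by
  unfold ballWeight
  split_ifs <;> simp

/-- The product of the mean projection lengths arising from successive intersections of a
hyperplane with `d - k - 1` isotropic random hyperplanes. -/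
noncomputable def sectionCoeff (d k : ℕ) : ℝ :=
  (kappa (d - 1) / (d * kappa d)) ^ (d - k - 1) *
    (((d - 1)! : ℝ) * kappa (d - 1) / ((k ! : ℝ) * kappa k))

theorem sectionCoeff_nonneg (d k : ℕ) : 0 ≤ sectionCoeff d k := by
  have := kappa_pos (d - 1)
  have := kappa_pos d
  have := kappa_pos k
  unfold sectionCoeff
  positivity

/-- Trades `(d-1)! κ_{d-1}` for `d! κ_d` times one more factor `κ_{d-1}/(d κ_d)`, the form used in
the final formulas. -/
theorem sectionCoeff_eq {k : ℕ} (hk : k < d) :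
    sectionCoeff d k = (kappa (d - 1) / (d * kappa d)) ^ (d - k) *
      ((d ! : ℝ) * kappa d / ((k ! : ℝ) * kappa k)) := by
  obtain ⟨D, rfl⟩ : ∃ D, d = D + 1 := ⟨d - 1, by omega⟩
  obtain ⟨m, hm⟩ : ∃ m, D + 1 - k = m + 1 := ⟨D - k, by omega⟩
  have := kappa_pos D
  have := kappa_pos (D + 1)
  have := kappa_pos k
  rw [sectionCoeff, hm, Nat.add_sub_cancel, Nat.add_sub_cancel, pow_succ, Nat.factorial_succ]
  push_cast
  field_simp

namespace IsHyperplaneSample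

variable (hX : IsHyperplaneSample P r (uniformHemisphere d) X) [IsProbabilityMeasure P]
include hX

/-- Each hyperplane contributes `1/(2r)`; against the `r`-power of the last integration and the
power of two from the Beta identity, exactly `(2r)^(a+b)` remains. -/
theorem integral_ballWeight_mul (hr : 0 < r) (a b : ℕ) {k l : ℕ} (hk : k < d) (hl : l < d) :
    ∫ ω, (ballWeight r a (⋂ i ∈ Finset.range (d - k), hyperplane (X i ω))).toReal *
        (ballWeight r b
          (⋂ i ∈ Finset.Ico (d - k - 1) (2 * d - k - l - 1), hyperplane (X i ω))).toReal ∂P =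
      sectionCoeff d k * (kappa (a + (d - k - 1)) / kappa a) *
        (sectionCoeff d l * (kappa (b + (d - l - 1)) / kappa b)) * (2 * r) ^ (a + b) *
        beta (((a + (d - k - 1) + (b + (d - l - 1)) : ℕ) : ℝ) / 2 + 1)
          (((a + (d - k - 1) + (b + (d - l - 1)) : ℕ) : ℝ) / 2 + 1) := by
  have hm : ∀ (c : ℕ) (S : Finset ℕ),
      AEMeasurable (fun ω => ballWeight r c (⋂ i ∈ S, hyperplane (X i ω))) P := by
    intro c S
    simpa using hX.aemeasurable_ballWeight isClosed_univ c S
  simp only [← ENNReal.toReal_mul]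
  have hmul : AEMeasurable (fun ω =>
      ballWeight r a (⋂ i ∈ Finset.range (d - k), hyperplane (X i ω)) *
        ballWeight r b (⋂ i ∈ Finset.Ico (d - k - 1) (2 * d - k - l - 1), hyperplane (X i ω))) P :=
    (hm _ _).mul (hm _ _)
  rw [integral_toReal hmul (Filter.Eventually.of_forall fun ω =>
    (ENNReal.mul_lt_top (ballWeight_ne_top _ _ _).lt_top (ballWeight_ne_top _ _ _).lt_top)),
    hX.lintegral_ballWeight_mul hr a b hk hl, kappa_succ_div_kappa_eq_beta]
  have hbeta : 0 < beta (((a + (d - k - 1) + (b + (d - l - 1)) : ℕ) : ℝ) / 2 + 1)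
      (((a + (d - k - 1) + (b + (d - l - 1)) : ℕ) : ℝ) / 2 + 1) :=
    beta_pos (by positivity) (by positivity)
  have := kappa_pos (d - 1)
  have := kappa_pos d
  have := kappa_pos k
  have := kappa_pos l
  have := kappa_pos a
  have := kappa_pos b
  have := kappa_pos (a + (d - k - 1))
  have := kappa_pos (b + (d - l - 1))
  rw [ENNReal.toReal_ofReal (by positivity), sectionCoeff, sectionCoeff]
  generalize beta (((a + (d - k - 1) + (b + (d - l - 1)) : ℕ) : ℝ) / 2 + 1)
      (((a + (d - k - 1) + (b + (d - l - 1)) : ℕ) : ℝ) / 2 + 1) = B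
  have hq : kappa (d - 1) / (d * kappa d) = kappa (d - 1) / (d * kappa d) / (2 * r) * (2 * r) := by
    field_simp
  generalize kappa (d - 1) / (d * kappa d) / (2 * r) = q at *
  rw [hq, mul_pow, mul_pow]
  generalize d - k - 1 = m
  generalize d - l - 1 = n
  have h2 : (2 : ℝ) ^ (a + m + (b + n) + 1) * B / (2 * r) * r ^ (a + m + (b + n) + 1) =
      (2 * r) ^ m * (2 * r) ^ n * (2 * r) ^ (a + b) * B := by
    field_simp
    ring
  rw [h2]
  ring

theorem sigmaChiMixed_eq (hr : 0 < r) {k l : ℕ} (hk : k < d) (hl : l < d) :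
    sigmaChiMixed P r X k l =
      sectionCoeff d k * kappa (d - k - 1) * (sectionCoeff d l * kappa (d - l - 1)) *
        beta ((2 * (d : ℝ) - k - l) / 2) ((2 * (d : ℝ) - k - l) / 2) := by
  have h := hX.integral_ballWeight_mul hr 0 0 hk hl
  have hc : ((0 + (d - k - 1) + (0 + (d - l - 1)) : ℕ) : ℝ) / 2 + 1 =
      (2 * (d : ℝ) - k - l) / 2 := by
    obtain ⟨m, rfl⟩ := Nat.exists_eq_add_of_lt hk
    obtain ⟨n, hn⟩ := Nat.exists_eq_add_of_lt hl
    rw [show k + m + 1 - k - 1 = m by omega, show k + m + 1 - l - 1 = n by omega]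
    have : ((k + m + 1 : ℕ) : ℝ) = ((l + n + 1 : ℕ) : ℝ) := by rw [hn]
    push_cast at this ⊢
    linarith
  rw [hc] at h
  simp only [sigmaChiMixed, chi_flatInBall hr.le, h, kappa_zero]
  simp

theorem sigmaNuMixed_eq (hr : 0 < r) {k l : ℕ} (hk : k < d) (hl : l < d) :
    sigmaNuMixed P r X k l =
      2 ^ k * sectionCoeff d k * kappa (d - 1) * (2 ^ l * sectionCoeff d l * kappa (d - 1)) *
        beta d d := by
  have h := hX.integral_ballWeight_mul hr k l hk hl
  -- The total exponent `2d - 2` does not involve `k` or `l`; this is why the volume moment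
  -- factorizes.
  have hc : ((k + (d - k - 1) + (l + (d - l - 1)) : ℕ) : ℝ) / 2 + 1 = d := by
    obtain ⟨D, rfl⟩ : ∃ D, d = D + 1 := ⟨d - 1, by omega⟩
    rw [show k + (D + 1 - k - 1) + (l + (D + 1 - l - 1)) = 2 * D by omega]
    push_cast
    ring
  rw [hc, show k + (d - k - 1) = d - 1 by omega, show l + (d - l - 1) = d - 1 by omega] at h
  have hae : ∀ᵐ ω ∂P, nu k (flatInBall r (fun i => X i ω) (Finset.range (d - k))) *
      nu l (flatInBall r (fun i => X i ω) (Finset.Ico (d - k - 1) (2 * d - k - l - 1))) =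
      kappa k * kappa l *
      ((ballWeight r k (⋂ i ∈ Finset.range (d - k), hyperplane (X i ω))).toReal *
        (ballWeight r l
          (⋂ i ∈ Finset.Ico (d - k - 1) (2 * d - k - l - 1), hyperplane (X i ω))).toReal) := by
    filter_upwards [hX.ae_euclideanHausdorffMeasure_flatInBall hr
        (k := k) (S := Finset.range (d - k)) (by simp; omega),
      hX.ae_euclideanHausdorffMeasure_flatInBall hr (k := l)
        (S := Finset.Ico (d - k - 1) (2 * d - k - l - 1)) (by simp; omega)] with ω h1 h2
    rw [nu, nu, h1, h2, ENNReal.toReal_mul, ENNReal.toReal_mul,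
      ENNReal.toReal_ofReal (kappa_pos _).le, ENNReal.toReal_ofReal (kappa_pos _).le]
    ring
  rw [sigmaNuMixed, integral_congr_ae hae, integral_const_mul, h]
  have := kappa_pos k
  have := kappa_pos l
  rw [mul_pow, pow_add 2]
  field_simp

end IsHyperplaneSample

theorem sigmaChiMixed_self (P : Measure Ω) (r : ℝ) (X : ℕ → Ω → ℝ × UnitSphere d) (k : ℕ) :
    sigmaChiMixed P r X k k = sigmaChi P r X k := by
  rw [sigmaChiMixed, sigmaChi, show 2 * d - k - k - 1 = 2 * d - 2 * k - 1 by omega]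

theorem sigmaNuMixed_self (P : Measure Ω) (r : ℝ) (X : ℕ → Ω → ℝ × UnitSphere d) (k : ℕ) :
    sigmaNuMixed P r X k k = sigmaNu P r X k := by
  rw [sigmaNuMixed, sigmaNu, show 2 * d - k - k - 1 = 2 * d - 2 * k - 1 by omega, two_mul k]

/-- For `k = l` each moment is a square times a Beta value; this extracts the geometric mean of two
such moments. -/
theorem sqrt_sq_mul_mul_sq_mul {x y s t : ℝ} (hx : 0 ≤ x) (hy : 0 ≤ y) :
    √(x * x * s * (y * y * t)) = x * y * √(s * t) := by
  rw [show x * x * s * (y * y * t) = (x * y) ^ 2 * (s * t) by ring, Real.sqrt_mul (by positivity),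
    Real.sqrt_sq (by positivity)]

end

end PoissonHyperplane

/-! ### Assembly of the four identities. -/

open PoissonHyperplane in
theorem lemma4p4 {Ω : Type*} [MeasurableSpace Ω] (P : Measure Ω) [IsProbabilityMeasure P]
    (d : ℕ) (r : ℝ) (hr : 0 < r)
    (X : ℕ → Ω → ℝ × PoissonHyperplane.UnitSphere d)
    (hX : PoissonHyperplane.IsHyperplaneSample P r (PoissonHyperplane.uniformHemisphere d) X)
    (k l : ℕ) (hk : k < d) (hl : l < d) :
    PoissonHyperplane.sigmaChiMixed P r X k l =
        ((d ! : ℝ) * PoissonHyperplane.kappa d) ^ 2 * PoissonHyperplane.kappa (d - k - 1) *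
            PoissonHyperplane.kappa (d - l - 1) * PoissonHyperplane.kappa (2 * d - k - l - 1) /
          ((k ! : ℝ) * (l ! : ℝ) * PoissonHyperplane.kappa k * PoissonHyperplane.kappa l *
            2 ^ (2 * d - k - l - 1) * PoissonHyperplane.kappa (2 * d - k - l - 2)) *
          (PoissonHyperplane.kappa (d - 1) / ((d : ℝ) * PoissonHyperplane.kappa d)) ^
            (2 * d - k - l) ∧
      PoissonHyperplane.sigmaChiMixed P r X k l =
        √(PoissonHyperplane.sigmaChi P r X k * PoissonHyperplane.sigmaChi P r X l) *
          (ProbabilityTheory.beta ((2 * (d : ℝ) - k - l) / 2) ((2 * (d : ℝ) - k - l) / 2) /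
            √(ProbabilityTheory.beta ((d : ℝ) - k) ((d : ℝ) - k) *
              ProbabilityTheory.beta ((d : ℝ) - l) ((d : ℝ) - l))) ∧
      PoissonHyperplane.sigmaNuMixed P r X k l =
        (PoissonHyperplane.kappa d * PoissonHyperplane.kappa (d - 1) * (d ! : ℝ) *
              ((d - 1)! : ℝ)) ^ 2 * 2 ^ (k + l) /
          ((k ! : ℝ) * (l ! : ℝ) * PoissonHyperplane.kappa k * PoissonHyperplane.kappa l *
            ((2 * d - 1)! : ℝ)) *
          (PoissonHyperplane.kappa (d - 1) / ((d : ℝ) * PoissonHyperplane.kappa d)) ^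
            (2 * d - k - l) ∧
      PoissonHyperplane.sigmaNuMixed P r X k l =
        √(PoissonHyperplane.sigmaNu P r X k * PoissonHyperplane.sigmaNu P r X l) := by
  have hchi := hX.sigmaChiMixed_eq hr hk hl
  have hnu := hX.sigmaNuMixed_eq hr hk hl
  have hc1 : 0 ≤ sectionCoeff d k := sectionCoeff_nonneg d k
  have hc2 : 0 ≤ sectionCoeff d l := sectionCoeff_nonneg d l
  obtain ⟨D, rfl⟩ : ∃ D, d = D + 1 := ⟨d - 1, by omega⟩
  have hκ := kappa_pos
  refine ⟨?_, ?_, ?_, ?_⟩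
  · obtain ⟨m, hm⟩ : ∃ m, D + 1 - k = m + 1 := ⟨D - k, by omega⟩
    obtain ⟨n, hn⟩ : ∃ n, D + 1 - l = n + 1 := ⟨D - l, by omega⟩
    -- Read backwards, with `m + n = 2d-k-l-2`: the Beta value becomes the quotient of ball volumes
    -- and the power of two in the claim.
    have hβ := kappa_succ_div_kappa_eq_beta (m + n)
    have he : ((m + n : ℕ) : ℝ) / 2 + 1 = (2 * ((D + 1 : ℕ) : ℝ) - k - l) / 2 := by
      have h1 : ((D + 1 : ℕ) : ℝ) = ((k + m + 1 : ℕ) : ℝ) := by congr 1; omega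
      have h2 : ((D + 1 : ℕ) : ℝ) = ((l + n + 1 : ℕ) : ℝ) := by congr 1; omega
      push_cast at h1 h2 ⊢
      linarith
    rw [he] at hβ
    rw [hchi, sectionCoeff_eq hk, sectionCoeff_eq hl, hm, hn,
      show 2 * (D + 1) - k - l = m + n + 2 by omega,
      show m + n + 2 - 1 = m + n + 1 by omega, show m + n + 2 - 2 = m + n by omega,
      Nat.add_sub_cancel m, Nat.add_sub_cancel n,
      show kappa (m + n + 1) = kappa (m + n + 1) / kappa (m + n) * kappa (m + n) from
        (div_mul_cancel₀ _ (hκ _).ne').symm, hβ]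
    have h1 := hκ k
    have h2 := hκ l
    have h3 := hκ (m + n)
    generalize kappa (D + 1 - 1) / (((D + 1 : ℕ) : ℝ) * kappa (D + 1)) = q
    field_simp
    ring
  · rw [← sigmaChiMixed_self, ← sigmaChiMixed_self, hX.sigmaChiMixed_eq hr hk hk,
      hX.sigmaChiMixed_eq hr hl hl, sqrt_sq_mul_mul_sq_mul (mul_nonneg hc1 (hκ _).le)
      (mul_nonneg hc2 (hκ _).le), hchi]
    have e : ∀ j : ℕ, (2 * ((D + 1 : ℕ) : ℝ) - j - j) / 2 = ((D + 1 : ℕ) : ℝ) - j := by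
      intro j; ring
    have hpos : ∀ j : ℕ, j < D + 1 →
        0 < ProbabilityTheory.beta (((D + 1 : ℕ) : ℝ) - j) (((D + 1 : ℕ) : ℝ) - j) := by
      intro j hj
      have : (j : ℝ) < ((D + 1 : ℕ) : ℝ) := by exact_mod_cast hj
      exact ProbabilityTheory.beta_pos (by linarith) (by linarith)
    rw [e, e]
    have := Real.sqrt_pos.2 (mul_pos (hpos k hk) (hpos l hl))
    field_simp
  · have hβ := beta_nat_succ D
    -- With `d = D + 1`, `B(d, d) = (D!)² / (2D+1)!` provides both factorials in `d` beyond `d!`.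
    rw [hnu, sectionCoeff_eq hk, sectionCoeff_eq hl, show 2 * (D + 1) - k - l =
      (D + 1 - k) + (D + 1 - l) by omega, show 2 * (D + 1) - 1 = 2 * D + 1 by omega,
      Nat.add_sub_cancel]
    push_cast
    rw [hβ]
    have h1 := hκ k
    have h2 := hκ l
    generalize kappa D / (((D : ℝ) + 1) * kappa (D + 1)) = q
    field_simp
    ring
  · have h1 : 0 ≤ 2 ^ k * sectionCoeff (D + 1) k * kappa (D + 1 - 1) :=
      mul_nonneg (by positivity) (hκ _).le
    have h2 : 0 ≤ 2 ^ l * sectionCoeff (D + 1) l * kappa (D + 1 - 1) :=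
      mul_nonneg (by positivity) (hκ _).le
    have h3 : 0 < ProbabilityTheory.beta ((D + 1 : ℕ) : ℝ) ((D + 1 : ℕ) : ℝ) :=
      ProbabilityTheory.beta_pos (by positivity) (by positivity)
    rw [← sigmaNuMixed_self, ← sigmaNuMixed_self, hX.sigmaNuMixed_eq hr hk hk,
      hX.sigmaNuMixed_eq hr hl hl, sqrt_sq_mul_mul_sq_mul h1 h2, hnu, Real.sqrt_mul_self h3.le]
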